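/- Let $(X,\mu)$ be a non-atomic probability space. A tree $\mathcal T$ on $X$ is a set of measurable subsets of $X$ of positive measure, with $X\in\mathcal T$, such that every $I\in\mathcal T$ has an at most countable set of children $C(I)\subseteq\mathcal T$ with at least two elements, which are pairwise almost disjoint (their intersections are null sets) and have union $I$; moreover $\mathcal T=\bigcup_{m\ge 0}\mathcal T_{(m)}$, where $\mathcal T_{(0)}=\{X\}$ and $\mathcal T_{(m+1)}=\bigcup_{I\in\mathcal T_{(m)}}C(I)$, and $\lim_{m\to\infty}\sup_{I\in\mathcal T_{(m)}}\mu(I)=0$. Let $\mathcal T$ be a tree on $X$ and, for $\varphi\in L^1(X,\mu)$ and $x\in X$, put $$\mathcal M\varphi(x)=\sup\Big\{\frac1{\mu(I)}\int_I|\varphi|\,d\mu:\ x\in I\in\mathcal T\Big\}.$$ For $p>1$ put $\|\psi\|_{p,\infty}=\sup_{\lambda>0}\lambda\,\mu(\{\psi\ge\lambda\})^{1/p}$ for $\psi\ge0$ and $|||\varphi|||_{p,\infty}=\sup\{\mu(E)^{-1+1/p}\int_E|\varphi|\,d\mu:\ E\subseteq X\text{ measurable},\ \mu(E)>0\}$.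 Let $1<q<p$, $\Gamma=\big(\frac{p-1}{p}\big)^q\frac{p}{p-q}$, $0<f\le F$ and $$f^q<A\le\Gamma\, f^{(p-q)/(p-1)}F^{p(q-1)/(p-1)}.$$ For $\lambda>0$ let $$G_{f,A}(\lambda)=\sup\Big\{\mu(\{\mathcal M\varphi\ge\lambda\}):\ \varphi\ge0,\ \int_X\varphi\,d\mu=f,\ \int_X\varphi^q\,d\mu=A\Big\}.$$ Then for every $\lambda>0$ $$\sup\Big\{\mu(\{\mathcal M\varphi\ge\lambda\}):\ \varphi\ge0,\ \int_X\varphi\,d\mu=f,\ \int_X\varphi^q\,d\mu=A,\ |||\varphi|||_{p,\infty}=F\Big\}=\min\Big\{1,\ G_{f,A}(\lambda),\ \frac{F^p}{\lambda^p}\Big\},$$ where $G_{f,A}(\lambda)=1$ if $\lambda\le f$, $G_{f,A}(\lambda)=f/\lambda$ if $f<\lambda<(A/f)^{1/(q-1)}$, and, if $\lambda\ge(A/f)^{1/(q-1)}$, $G_{f,A}(\lambda)$ is the unique root $\alpha\in[0,f/\lambda]$ of $$\frac{(f-\alpha\lambda)^q}{(1-\alpha)^{q-1}}+\alpha\lambda^q=A.$$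 Moreover $$\sup\Big\{\|\mathcal M\varphi\|_{p,\infty}:\ \varphi\ge0,\ \int_X\varphi\,d\mu=f,\ \int_X\varphi^q\,d\mu=A,\ |||\varphi|||_{p,\infty}=F\Big\}=F,$$ so the inequality $\|\mathcal M\varphi\|_{p,\infty}\le|||\varphi|||_{p,\infty}$ is sharp on this class. -/

import Mathlib

open MeasureTheory Filter Topology
open scoped ENNReal

namespace TreeMaximal

variable {X : Type*} [MeasurableSpace X]

/-- Non-atomic measure: every measurable set of positive measure has a measurable subset of
strictly smaller positive measure. (Mathlib's `NoAtoms` only says that points are null sets.) -/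
def IsNonatomic (μ : Measure X) : Prop :=
  ∀ E, MeasurableSet E → 0 < μ E → ∃ B ⊆ E, MeasurableSet B ∧ 0 < μ B ∧ μ B < μ E

/-- The `m`-th generation of the tree whose root is the whole space and in which
the children of `I` are the elements of `C I`. -/
def level (C : Set X → Set (Set X)) : ℕ → Set (Set X)
  | 0 => {Set.univ}
  | m + 1 => ⋃ I ∈ level C m, C I

/-- `T` is a tree on `(X, μ)` with the family of children `I ↦ C I`. -/
structure IsTreeWith (μ : Measure X) (T : Set (Set X)) (C : Set X → Set (Set X)) : Prop where
  measurableSet : ∀ I ∈ T, MeasurableSet I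
  univ_mem : Set.univ ∈ T
  measure_pos : ∀ I ∈ T, 0 < μ I
  children_subset : ∀ I ∈ T, C I ⊆ T
  children_countable : ∀ I ∈ T, (C I).Countable
  children_nontrivial : ∀ I ∈ T, (C I).Nontrivial
  children_aedisjoint : ∀ I ∈ T, (C I).Pairwise (fun J K => μ (J ∩ K) = 0)
  sUnion_children : ∀ I ∈ T, I = ⋃₀ C I
  eq_iUnion_level : T = ⋃ m, level C m
  tendsto_measure : Tendsto (fun m => ⨆ I ∈ level C m, μ I) atTop (𝓝 0)

/-- `T` is a tree on `(X, μ)`. -/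
def IsTree (μ : Measure X) (T : Set (Set X)) : Prop :=
  ∃ C : Set X → Set (Set X), IsTreeWith μ T C

/-- The maximal operator of the tree: the supremum of the averages of `|φ|` over the elements of
`T` that contain `x`. -/
noncomputable def maximal (μ : Measure X) (T : Set (Set X)) (φ : X → ℝ) (x : X) : ℝ≥0∞ :=
  ⨆ I ∈ T, ⨆ _ : x ∈ I, (μ I)⁻¹ * ∫⁻ y in I, ‖φ y‖ₑ ∂μ

/-- The quasi-norm `‖ψ‖_{p,∞}` of a function with values in `[0, ∞]`. -/
noncomputable def weakQuasiNorm (μ : Measure X) (p : ℝ) (ψ : X → ℝ≥0∞) : ℝ≥0∞ :=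
  ⨆ t : ℝ, ⨆ _ : 0 < t, ENNReal.ofReal t * μ {x | ENNReal.ofReal t ≤ ψ x} ^ (1 / p)

/-- The norm `|||φ|||_{p,∞}`. -/
noncomputable def weakNorm (μ : Measure X) (p : ℝ) (φ : X → ℝ) : ℝ≥0∞ :=
  ⨆ E : Set X, ⨆ _ : MeasurableSet E, ⨆ _ : 0 < μ E,
    μ E ^ (-1 + 1 / p) * ∫⁻ x in E, ‖φ x‖ₑ ∂μ

/-- Nonnegative functions with `∫ φ = f` and `∫ φ ^ q = A`. -/
def classLq (μ : Measure X) (q f A : ℝ) : Set (X → ℝ) :=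
  {φ | (∀ x, 0 ≤ φ x) ∧ Integrable φ μ ∧ ∫ x, φ x ∂μ = f ∧
    Integrable (fun x => φ x ^ q) μ ∧ ∫ x, φ x ^ q ∂μ = A}

/-- Nonnegative functions with `∫ φ = f`, `∫ φ ^ q = A` and `|||φ|||_{p,∞} = F`. -/
def classLqWeak (μ : Measure X) (p q f A F : ℝ) : Set (X → ℝ) :=
  {φ | φ ∈ classLq μ q f A ∧ weakNorm μ p φ = ENNReal.ofReal F}

/-- The extremal function `G_{f,A}(l)` of the problem without the weak-`L^p` restriction. -/
noncomputable def extremalG (μ : Measure X) (T : Set (Set X)) (q f A l : ℝ) : ℝ≥0∞ :=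
  ⨆ φ ∈ classLq μ q f A, μ {x | ENNReal.ofReal l ≤ maximal μ T φ x}

/-- The constant `Γ = ((p - 1) / p) ^ q * p / (p - q)`. -/
noncomputable def Gam (p q : ℝ) : ℝ := ((p - 1) / p) ^ q * (p / (p - q))

end TreeMaximal

/-! Write r = 1 - 1/p and let E be the level set where the maximal function of φ is at least l.
Every bound from above rests on l μ(E) ≤ ∫_E φ, obtained from a stopping decomposition of the strict
level sets into almost disjoint tree elements. Combined with ∫_E φ ≤ F μ(E)^r it gives μ(E) ≤ F^p /
l^p. Combined with ∫ φ^q = A and convexity it gives `minPower q f l (μ E) ≤ A` when l > f. Since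
`minPower` is strictly increasing on [0, f/l], μ(E) cannot exceed f/l, nor the root of `minPower =
A` when there is one. When l ≤ f, the average over the whole space already makes E everything.

For the converse, suppose α is such that all these constraints hold strictly. It suffices to find a
decreasing g on (0, 1] with ∫_0^1 g = f, ∫_0^1 g^q = A, ∫_0^t g ≤ F t^r with equality near 0, and
∫_0^α g ≥ lα (`IsProfile`). One such profile, apart from the condition on g^q, is a tiny power spike
followed by the values l and c, the spike costing almost no q-power (`exists_isProfile_lt`); another
is a truncated power, whose q-integral is the upper bound imposed on A (`exists_isProfile_max`). The
conditions other than the q-integral survive convex combinations, so the intermediate value theorem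
gives q-integral exactly A.

The profile is carried to X as φ = g ∘ θ. Here θ is uniform on (0, 1], and also uniform on (0, α]
over each of finitely many pieces, of total measure α, that agree with tree elements up to null
sets. Each such element then has average at least l. Equality near 0 makes the weak norm exactly F.

The value of G follows from the same construction with an auxiliary exponent and a large F. The last
supremum is F because F^p / l^p is the binding constraint for large l. -/

namespace TreeMaximal

variable {X : Type*} [MeasurableSpace X]

/-! ### Structure of the tree and the weak-type inequality -/

namespace IsTreeWith

variable {μ : Measure X} {T : Set (Set X)} {C : Set X → Set (Set X)}

theorem level_subset (h : IsTreeWith μ T C) (m : ℕ) : level C m ⊆ T := by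
  rw [h.eq_iUnion_level]
  exact Set.subset_iUnion (level C) m

theorem countable_level (h : IsTreeWith μ T C) (m : ℕ) : (level C m).Countable := by
  induction m with
  | zero => exact Set.countable_singleton _
  | succ m ih => exact ih.biUnion fun I hI => h.children_countable I (h.level_subset m hI)

theorem countable (h : IsTreeWith μ T C) : T.Countable := by
  rw [h.eq_iUnion_level]
  exact Set.countable_iUnion h.countable_level

theorem exists_mem_level (h : IsTreeWith μ T C) (m : ℕ) (x : X) : ∃ I ∈ level C m, x ∈ I := by
  induction m with
  | zero => exact ⟨Set.univ, rfl, trivial⟩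
  | succ m ih =>
    obtain ⟨I, hI, hx⟩ := ih
    rw [h.sUnion_children I (h.level_subset m hI)] at hx
    obtain ⟨J, hJ, hxJ⟩ := hx
    exact ⟨J, Set.mem_biUnion hI hJ, hxJ⟩

theorem exists_ancestor (h : IsTreeWith μ T C) {i j : ℕ} (hij : i ≤ j) {J : Set X}
    (hJ : J ∈ level C j) : ∃ I ∈ level C i, J ⊆ I := by
  induction j, hij using Nat.le_induction generalizing J with
  | base => exact ⟨J, hJ, subset_rfl⟩
  | succ j _ ih =>
    obtain ⟨K, hK, hJK⟩ := Set.mem_iUnion₂.1 hJ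
    obtain ⟨I, hI, hKI⟩ := ih hK
    refine ⟨I, hI, Set.Subset.trans ?_ hKI⟩
    rw [h.sUnion_children K (h.level_subset j hK)]
    exact Set.subset_sUnion_of_mem hJK

theorem pairwise_level (h : IsTreeWith μ T C) (m : ℕ) :
    (level C m).Pairwise (fun J K => μ (J ∩ K) = 0) := by
  induction m with
  | zero => exact Set.pairwise_singleton _ _
  | succ m ih =>
    intro J hJ K hK hne
    obtain ⟨J', hJ', hJ⟩ := Set.mem_iUnion₂.1 hJ
    obtain ⟨K', hK', hK⟩ := Set.mem_iUnion₂.1 hK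
    by_cases heq : J' = K'
    · subst heq
      exact h.children_aedisjoint J' (h.level_subset m hJ') hJ hK hne
    · refine measure_mono_null (Set.inter_subset_inter ?_ ?_) (ih hJ' hK' heq)
      · rw [h.sUnion_children J' (h.level_subset m hJ')]
        exact Set.subset_sUnion_of_mem hJ
      · rw [h.sUnion_children K' (h.level_subset m hK')]
        exact Set.subset_sUnion_of_mem hK

/-- The space is partitioned into countably many pieces, each of which is, up to a null set,
an element of the tree of small measure. -/
theorem exists_partition (h : IsTreeWith μ T C) {δ : ℝ≥0∞} (hδ : 0 < δ) :
    ∃ κ : X → ℕ, Measurable κ ∧ ∀ j, (κ ⁻¹' {j}).Nonempty →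
      ∃ I ∈ T, κ ⁻¹' {j} ⊆ I ∧ κ ⁻¹' {j} =ᵐ[μ] I ∧ μ I < δ := by
  classical
  obtain ⟨m, hm⟩ := (h.tendsto_measure.eventually (gt_mem_nhds hδ)).exists
  have hne : (level C m).Nonempty ∨ IsEmpty X := by
    rcases isEmpty_or_nonempty X with hX | ⟨⟨x⟩⟩
    · exact Or.inr hX
    · obtain ⟨I, hI, -⟩ := h.exists_mem_level m x
      exact Or.inl ⟨I, hI⟩
  rcases hne with hne | hX
  swap
  · exact ⟨fun _ => 0, measurable_const, fun j ⟨x, _⟩ => (hX.false x).elim⟩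
  obtain ⟨e, he⟩ := (h.countable_level m).exists_eq_range hne
  have hmem : ∀ n, e n ∈ level C m := fun n => he ▸ Set.mem_range_self n
  have hmeas : ∀ n, MeasurableSet (e n) :=
    fun n => h.measurableSet _ (h.level_subset m (hmem n))
  have hex : ∀ x, ∃ n, x ∈ e n := by
    intro x
    obtain ⟨I, hI, hx⟩ := h.exists_mem_level m x
    rw [he] at hI
    obtain ⟨n, rfl⟩ := hI
    exact ⟨n, hx⟩
  refine ⟨fun x => Nat.find (hex x), measurable_find hex hmeas, ?_⟩
  rintro j ⟨x₀, hx₀⟩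
  have hx₀' : Nat.find (hex x₀) = j := hx₀
  have hsub : (fun x => Nat.find (hex x)) ⁻¹' {j} ⊆ e j := by
    intro x hx
    have hx' : Nat.find (hex x) = j := hx
    rw [← hx']
    exact Nat.find_spec (hex x)
  refine ⟨e j, h.level_subset m (hmem j), hsub, ?_, ?_⟩
  · refine Filter.EventuallyLE.antisymm (Eventually.of_forall hsub) ?_
    have hnull : μ (⋃ i ∈ Finset.range j, e j ∩ e i) = 0 := by
      refine (measure_biUnion_null_iff (Finset.range j).countable_toSet).2 fun i hi => ?_
      refine h.pairwise_level m (hmem j) (hmem i) fun heq => ?_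
      have hlt : i < Nat.find (hex x₀) := by rw [hx₀']; simpa using hi
      exact Nat.find_min (hex x₀) hlt (heq ▸ hsub hx₀)
    filter_upwards [measure_eq_zero_iff_ae_notMem.1 hnull] with x hx hxj
    refine (Nat.find_eq_iff (hex x)).2 ⟨hxj, fun i hi hxi => hx ?_⟩
    exact Set.mem_biUnion (by simpa using hi) ⟨hxj, hxi⟩
  · exact (le_iSup₂ (f := fun I (_ : I ∈ level C m) => μ I) (e j) (hmem j)).trans_lt hm

theorem measurable_maximal (h : IsTreeWith μ T C) (φ : X → ℝ) : Measurable (maximal μ T φ) := by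
  refine Measurable.biSup T h.countable fun I hI => ?_
  classical
  have : (fun x => ⨆ _ : x ∈ I, (μ I)⁻¹ * ∫⁻ y in I, ‖φ y‖ₑ ∂μ) =
      I.indicator fun _ => (μ I)⁻¹ * ∫⁻ y in I, ‖φ y‖ₑ ∂μ := by
    ext x
    by_cases hx : x ∈ I <;> simp [hx]
  rw [this]
  exact measurable_const.indicator (h.measurableSet I hI)

/-- Calderón–Zygmund stopping: the strict level set is an almost disjoint union of tree elements
with average above c, over which the inequality is summed. -/
theorem mul_measure_lt_maximal_le [IsFiniteMeasure μ] (h : IsTreeWith μ T C) (φ : X → ℝ)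
    (c : ℝ≥0∞) :
    c * μ {x | c < maximal μ T φ x} ≤ ∫⁻ x in {x | c < maximal μ T φ x}, ‖φ x‖ₑ ∂μ := by
  classical
  set a : Set X → ℝ≥0∞ := fun I => (μ I)⁻¹ * ∫⁻ y in I, ‖φ y‖ₑ ∂μ with ha
  -- The stopping family: average above c, while every containing element of an earlier generation
  -- has average at most c.
  set S : Set (Set X) := {I | c < a I ∧ ∃ j, I ∈ level C j ∧
    ∀ i < j, ∀ K ∈ level C i, I ⊆ K → a K ≤ c} with hS
  have hST : S ⊆ T := fun I hI => by
    obtain ⟨-, j, hj, -⟩ := hI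
    exact h.level_subset j hj
  have hcount : S.Countable := h.countable.mono hST
  have hdisj : S.Pairwise (Function.onFun (AEDisjoint μ) fun I => I) := by
    have key : ∀ I ∈ S, ∀ J ∈ S, I ≠ J → ∀ i j, i ≤ j → I ∈ level C i → J ∈ level C j →
        (∀ k < j, ∀ K ∈ level C k, J ⊆ K → a K ≤ c) → μ (I ∩ J) = 0 := by
      intro I hI J hJ hne i j hij hIi hJj hmin
      rcases hij.eq_or_lt with rfl | hlt
      · exact h.pairwise_level i hIi hJj hne
      · obtain ⟨K, hK, hJK⟩ := h.exists_ancestor hij hJj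
        have hIK : I ≠ K := by
          rintro rfl
          exact (hmin i hlt I hK hJK).not_gt hI.1
        exact measure_mono_null (Set.inter_subset_inter_right I hJK) (h.pairwise_level i hIi hK hIK)
    intro I hI J hJ hne
    obtain ⟨-, i, hi, hi'⟩ := id hI
    obtain ⟨-, j, hj, hj'⟩ := id hJ
    rcases le_total i j with hij | hij
    · exact key I hI J hJ hne i j hij hi hj hj'
    · change μ (I ∩ J) = 0
      rw [Set.inter_comm]
      exact key J hJ I hI hne.symm j i hij hj hi hi'
  have hunion : {x | c < maximal μ T φ x} = ⋃ I ∈ S, I := by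
    ext x
    simp only [Set.mem_ofPred_eq, maximal, lt_iSup_iff, Set.mem_iUnion, exists_prop]
    constructor
    · rintro ⟨I, hIT, hxI, hI⟩
      rw [h.eq_iUnion_level] at hIT
      obtain ⟨j, hj⟩ := Set.mem_iUnion.1 hIT
      clear hIT
      induction j using Nat.strong_induction_on generalizing I with
      | _ j ih =>
        by_cases hmin : ∀ i < j, ∀ K ∈ level C i, I ⊆ K → a K ≤ c
        · exact ⟨I, ⟨hI, j, hj, hmin⟩, hxI⟩
        · push Not at hmin
          obtain ⟨i, hij, K, hK, hIK, hcK⟩ := hmin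
          exact ih i hij K (hIK hxI) hcK hK
    · rintro ⟨I, hI, hxI⟩
      exact ⟨I, hST hI, hxI, hI.1⟩
  have hnull : ∀ I ∈ S, NullMeasurableSet I μ :=
    fun I hI => (h.measurableSet I (hST hI)).nullMeasurableSet
  rw [hunion, measure_biUnion₀ hcount hdisj hnull, lintegral_biUnion₀ hcount hnull hdisj,
    ← ENNReal.tsum_mul_left]
  refine ENNReal.tsum_le_tsum fun ⟨I, hI⟩ => ?_
  have hpos := (h.measure_pos I (hST hI)).ne'
  calc c * μ I ≤ a I * μ I := by gcongr; exact hI.1.le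
    _ = ∫⁻ y in I, ‖φ y‖ₑ ∂μ := by
      rw [ha]
      simp only
      rw [mul_comm, ← mul_assoc, ENNReal.mul_inv_cancel hpos (measure_ne_top μ I), one_mul]

/-- The supremum defining `maximal` need not be attained, so the closed level set is treated as a
decreasing intersection of strict ones, with continuity from above of the finite measure |φ| dμ. -/
theorem mul_measure_le_maximal_le [IsFiniteMeasure μ] (h : IsTreeWith μ T C) {φ : X → ℝ}
    (hφ : Integrable φ μ) {l : ℝ} (hl : 0 < l) :
    ENNReal.ofReal l * μ {x | ENNReal.ofReal l ≤ maximal μ T φ x} ≤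
      ∫⁻ x in {x | ENNReal.ofReal l ≤ maximal μ T φ x}, ‖φ x‖ₑ ∂μ := by
  set M := maximal μ T φ
  have hM : Measurable M := h.measurable_maximal φ
  obtain ⟨c, hcmono, hclt, hclim⟩ := exists_seq_strictMono_tendsto' (ENNReal.ofReal_pos.2 hl)
  set E := {x | ENNReal.ofReal l ≤ M x}
  have hE : E = ⋂ n, {x | c n < M x} := by
    ext x
    simp only [E, Set.mem_ofPred_eq, Set.mem_iInter]
    exact ⟨fun hx n => (hclt n).2.trans_le hx,
      fun hx => le_of_tendsto' hclim fun n => (hx n).le⟩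
  have hmeas : ∀ n, MeasurableSet {x | c n < M x} := fun n => measurableSet_lt measurable_const hM
  let ν := μ.withDensity fun x => ‖φ x‖ₑ
  have : IsFiniteMeasure ν := isFiniteMeasure_withDensity hφ.2.ne
  have hν : ∀ s, MeasurableSet s → ν s = ∫⁻ x in s, ‖φ x‖ₑ ∂μ := fun s hs => withDensity_apply _ hs
  have hlim : Tendsto (fun n => ν {x | c n < M x}) atTop (𝓝 (ν E)) := by
    rw [hE]
    refine tendsto_measure_iInter_atTop (fun n => (hmeas n).nullMeasurableSet) ?_
      ⟨0, measure_ne_top _ _⟩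
    exact fun i j hij x hx => (hcmono.monotone hij).trans_lt hx
  have hlim' : Tendsto (fun n => c n * μ E) atTop (𝓝 (ENNReal.ofReal l * μ E)) :=
    ENNReal.Tendsto.mul_const hclim (Or.inr (measure_ne_top μ E))
  rw [← hν E (measurableSet_le measurable_const hM)]
  refine le_of_tendsto_of_tendsto' hlim' hlim fun n => ?_
  rw [hν _ (hmeas n)]
  refine le_trans ?_ (h.mul_measure_lt_maximal_le φ (c n))
  gcongr
  exact fun x hx => (hclt n).2.trans_le hx

end IsTreeWith

/-! ### Uniformly distributed functions adapted to the tree -/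

/-- Each point is coded by its pieces in partitions of mesh 1/(m+1), and the code is embedded in ℝ.
A fibre lies in tree elements of arbitrarily small measure. This supplies a diffuse law to which a
distribution function can be applied. -/
theorem IsTreeWith.exists_measurable_null_fibers {μ : Measure X} {T : Set (Set X)}
    {C : Set X → Set (Set X)} (h : IsTreeWith μ T C) :
    ∃ v : X → ℝ, Measurable v ∧ ∀ y, μ (v ⁻¹' {y}) = 0 := by
  choose κ hκ hκ' using fun m : ℕ =>
    h.exists_partition (δ := ((m : ℝ≥0∞) + 1)⁻¹) (by simp)
  have he := measurableEmbedding_embeddingReal (ℕ → ℕ)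
  refine ⟨fun x => embeddingReal (ℕ → ℕ) fun m => κ m x,
    he.measurable.comp (measurable_pi_lambda _ hκ), fun y => ?_⟩
  rcases Set.eq_empty_or_nonempty
    ((fun x => embeddingReal (ℕ → ℕ) fun m => κ m x) ⁻¹' {y}) with hem | ⟨x₀, hx₀⟩
  · rw [hem, measure_empty]
  have hsub : ∀ m, (fun x => embeddingReal (ℕ → ℕ) fun m => κ m x) ⁻¹' {y} ⊆
      κ m ⁻¹' {κ m x₀} := by
    intro m x hx
    exact congrFun (he.injective ((Set.mem_singleton_iff.1 hx).trans
      (Set.mem_singleton_iff.1 hx₀).symm)) m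
  have hlim : Tendsto (fun m : ℕ => ((m : ℝ≥0∞) + 1)⁻¹) atTop (𝓝 0) := by
    have := (tendsto_add_atTop_iff_nat 1).2 ENNReal.tendsto_inv_nat_nhds_zero
    simpa using this
  refine le_antisymm (ge_of_tendsto' hlim fun m => ?_) zero_le
  obtain ⟨I, -, hI, -, hlt⟩ := hκ' m (κ m x₀) ⟨x₀, rfl⟩
  exact (measure_mono ((hsub m).trans hI)).trans hlt.le

theorem continuous_cdf (P : Measure ℝ) [IsProbabilityMeasure P] [NullSingletonClass P] :
    Continuous (ProbabilityTheory.cdf P) := by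
  refine continuous_iff_continuousAt.2 fun x => ?_
  rw [(ProbabilityTheory.monotone_cdf P).continuousAt_iff_leftLim_eq_rightLim,
    StieltjesFunction.rightLim_eq]
  have h0 : (ProbabilityTheory.cdf P).measure {x} = 0 := by
    rw [ProbabilityTheory.measure_cdf, measure_singleton]
  rw [StieltjesFunction.measure_singleton, ENNReal.ofReal_eq_zero] at h0
  exact le_antisymm ((ProbabilityTheory.monotone_cdf P).leftLim_le le_rfl) (by linarith)

/-- The probability integral transform. -/
theorem map_cdf (P : Measure ℝ) [IsProbabilityMeasure P] [NullSingletonClass P] :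
    P.map (ProbabilityTheory.cdf P) = volume.restrict (Set.Ioc 0 1) := by
  set G := ProbabilityTheory.cdf P
  have hmono : Monotone G := ProbabilityTheory.monotone_cdf P
  have hcont : Continuous G := continuous_cdf P
  have hP : ∀ y, P (Set.Iic y) = ENNReal.ofReal (G y) := fun y =>
    (ProbabilityTheory.ofReal_cdf P y).symm
  have hrange : ∀ t, 0 < t → t < 1 → ∃ y, G y = t := fun t h0 h1 =>
    mem_range_of_exists_le_of_exists_ge hcont
      (((ProbabilityTheory.tendsto_cdf_atBot P).eventually (ge_mem_nhds h0)).exists)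
      (((ProbabilityTheory.tendsto_cdf_atTop P).eventually (le_mem_nhds h1)).exists)
  have : IsProbabilityMeasure (P.map G) := Measure.isProbabilityMeasure_map hcont.aemeasurable
  refine Measure.ext_of_Iic _ _ fun a => ?_
  rw [Measure.map_apply hcont.measurable measurableSet_Iic, Measure.restrict_apply measurableSet_Iic]
  rcases lt_or_ge a 0 with ha | ha
  · have h1 : G ⁻¹' Set.Iic a = ∅ := by
      ext y
      simpa using ha.trans_le (ProbabilityTheory.cdf_nonneg P y)
    have h2 : Set.Iic a ∩ Set.Ioc (0 : ℝ) 1 = ∅ := by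
      ext y
      simp only [Set.mem_inter_iff, Set.mem_Iic, Set.mem_Ioc, Set.mem_empty_iff_false, iff_false]
      intro hy
      linarith [hy.1, hy.2.1]
    rw [h1, h2, measure_empty, measure_empty]
  rcases le_or_gt 1 a with ha1 | ha1
  · have h1 : G ⁻¹' Set.Iic a = Set.univ := by
      ext y
      simpa using (ProbabilityTheory.cdf_le_one P y).trans ha1
    have h2 : Set.Iic a ∩ Set.Ioc (0 : ℝ) 1 = Set.Ioc 0 1 :=
      Set.inter_eq_right.2 fun y hy => hy.2.trans ha1
    rw [h1, h2, measure_univ, Real.volume_Ioc]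
    simp
  · have h2 : Set.Iic a ∩ Set.Ioc (0 : ℝ) 1 = Set.Ioc 0 a := by
      ext y
      simp only [Set.mem_inter_iff, Set.mem_Iic, Set.mem_Ioc]
      exact ⟨fun hy => ⟨hy.2.1, hy.1⟩, fun hy => ⟨hy.2, hy.1, hy.2.trans ha1.le⟩⟩
    rw [h2, Real.volume_Ioc, sub_zero]
    refine le_antisymm ?_ ?_
    -- `G` may be constant at height a, so {G ≤ a} is compared with {z ≤ y} where G y = t > a, and
    -- then t ↓ a.
    · have hlim : Tendsto (fun t => ENNReal.ofReal t) (𝓝[>] a) (𝓝 (ENNReal.ofReal a)) :=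
        (ENNReal.continuous_ofReal.tendsto a).mono_left nhdsWithin_le_nhds
      refine ge_of_tendsto hlim ?_
      filter_upwards [Ioo_mem_nhdsGT ha1] with t ht
      obtain ⟨y, hy⟩ := hrange t (ha.trans_lt ht.1) ht.2
      rw [← hy, ← hP y]
      refine measure_mono fun z hz => ?_
      by_contra hzy
      have h3 : G y ≤ G z := hmono (not_le.1 hzy).le
      have h4 : G z ≤ a := hz
      linarith [ht.1]
    · rcases ha.eq_or_lt with rfl | ha0
      · simp
      · obtain ⟨y, hy⟩ := hrange a ha0 ha1
        rw [← hy, ← hP y]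
        exact measure_mono fun z hz => hmono hz

theorem map_affine_volume_restrict {a b : ℝ} (hab : a < b) :
    (volume.restrict (Set.Ioc (0 : ℝ) 1)).map (fun x => a + (b - a) * x) =
      (ENNReal.ofReal (b - a))⁻¹ • volume.restrict (Set.Ioc a b) := by
  have hba : 0 < b - a := sub_pos.2 hab
  have hmeas : Measurable fun x : ℝ => a + (b - a) * x := by fun_prop
  have h1 : (volume : Measure ℝ).map (fun x => a + (b - a) * x) =
      (ENNReal.ofReal (b - a))⁻¹ • volume := by
    have : (fun x : ℝ => a + (b - a) * x) = (fun x => a + x) ∘ fun x => (b - a) * x := rfl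
    rw [this, ← Measure.map_map (by fun_prop) (by fun_prop), Real.map_volume_mul_left hba.ne',
      Measure.map_smul, map_add_left_eq_self, abs_of_pos (inv_pos.2 hba),
      ENNReal.ofReal_inv_of_pos hba]
  rw [← Measure.restrict_smul, ← h1, Measure.restrict_map hmeas measurableSet_Ioc]
  congr 2
  ext x
  simp only [Set.mem_Ioc, Set.mem_preimage]
  constructor
  · rintro ⟨h0, h1⟩
    constructor <;> nlinarith
  · rintro ⟨h0, h1⟩
    constructor <;> nlinarith

/-- The law of v under the normalised measure on S is pushed through its own distribution function
and rescaled. The bound a ≤ u holds everywhere, because profiles are controlled only on [0, ∞). -/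
theorem exists_uniform_on {μ : Measure X} [IsFiniteMeasure μ] {v : X → ℝ} (hv : Measurable v)
    (hv0 : ∀ y, μ (v ⁻¹' {y}) = 0) {S : Set X} {a b : ℝ} (hab : a < b) :
    ∃ u : X → ℝ, Measurable u ∧ (∀ x, a ≤ u x) ∧ (μ.restrict S).map u =
      (μ S * (ENNReal.ofReal (b - a))⁻¹) • volume.restrict (Set.Ioc a b) := by
  rcases eq_or_ne (μ S) 0 with h0 | h0
  · exact ⟨fun _ => a, measurable_const, fun _ => le_rfl, by
      simp [Measure.restrict_eq_zero.2 h0, h0]⟩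
  have hprob : IsProbabilityMeasure ((μ S)⁻¹ • μ.restrict S) := ⟨by
    simp [ENNReal.inv_mul_cancel h0 (measure_ne_top μ S)]⟩
  set P := ((μ S)⁻¹ • μ.restrict S).map v with hP
  have : IsProbabilityMeasure P := Measure.isProbabilityMeasure_map hv.aemeasurable
  have hna : NullSingletonClass P := ⟨fun y => by
    rw [hP, Measure.map_apply hv (measurableSet_singleton y), Measure.smul_apply,
      Measure.restrict_apply (hv (measurableSet_singleton y)),
      measure_mono_null Set.inter_subset_left (hv0 y), smul_zero]⟩
  have hG : Measurable (ProbabilityTheory.cdf P) := (continuous_cdf P).measurable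
  have haff : Measurable fun x : ℝ => a + (b - a) * x := by fun_prop
  refine ⟨fun x => a + (b - a) * ProbabilityTheory.cdf P (v x), haff.comp (hG.comp hv), ?_, ?_⟩
  · intro x
    have := mul_nonneg (sub_pos.2 hab).le (ProbabilityTheory.cdf_nonneg P (v x))
    linarith
  · have h1 : μ.restrict S = μ S • ((μ S)⁻¹ • μ.restrict S) := by
      rw [smul_smul, ENNReal.mul_inv_cancel h0 (measure_ne_top μ S), one_smul]
    have h2 : (fun x => a + (b - a) * ProbabilityTheory.cdf P (v x)) =
      (fun x => a + (b - a) * x) ∘ ProbabilityTheory.cdf P ∘ v := rfl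
    rw [h1, h2, Measure.map_smul, ← Measure.map_map haff (hG.comp hv), ← Measure.map_map hG hv,
      ← hP, map_cdf, map_affine_volume_restrict hab, smul_smul]

/-- A function with uniform distribution on `(0, 1]`, which is uniformly distributed on `(0, α]`
on each of the first `n` pieces of a partition of total measure `α`. -/
theorem exists_uniform_of_partition {μ : Measure X} [IsProbabilityMeasure μ] {v : X → ℝ}
    (hv : Measurable v) (hv0 : ∀ y, μ (v ⁻¹' {y}) = 0) {κ : X → ℕ} (hκ : Measurable κ) (n : ℕ)
    {α : ℝ} (hα0 : 0 < α) (hα1 : α < 1) (hα : μ (κ ⁻¹' Set.Iio n) = ENNReal.ofReal α) :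
    ∃ θ : X → ℝ, Measurable θ ∧ (∀ x, 0 ≤ θ x) ∧ μ.map θ = volume.restrict (Set.Ioc 0 1) ∧
      ∀ j < n, (μ.restrict (κ ⁻¹' {j})).map θ =
        (μ (κ ⁻¹' {j}) * (ENNReal.ofReal α)⁻¹) • volume.restrict (Set.Ioc 0 α) := by
  classical
  have hS : ∀ j, MeasurableSet (κ ⁻¹' {j}) := fun j => hκ (measurableSet_singleton j)
  have hE : MeasurableSet (κ ⁻¹' Set.Iio n) := hκ measurableSet_Iio
  choose u hu hu0 humap using fun j => exists_uniform_on (S := κ ⁻¹' {j}) hv hv0 hα0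
  obtain ⟨w, hw, hw0, hwmap⟩ := exists_uniform_on (S := (κ ⁻¹' Set.Iio n)ᶜ) hv hv0 hα1
  -- `u j` fills (0, α] on the j-th piece and `w` fills (α, 1] off the first n pieces.
  let θ : X → ℝ := fun x => if κ x < n then u (κ x) x else w x
  have hθ : Measurable θ := by
    refine Measurable.ite hE ?_ hw
    exact measurable_from_prod_countable_right (f := fun z : ℕ × X => u z.1 z.2) hu |>.comp
      (hκ.prodMk measurable_id)
  have hθu : ∀ j < n, (μ.restrict (κ ⁻¹' {j})).map θ = (μ.restrict (κ ⁻¹' {j})).map (u j) := by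
    intro j hj
    refine Measure.map_congr ((ae_restrict_iff' (hS j)).2 (Eventually.of_forall fun x hx => ?_))
    have hx' : κ x = j := hx
    simp [θ, hx', hj]
  have hθw : (μ.restrict (κ ⁻¹' Set.Iio n)ᶜ).map θ = (μ.restrict (κ ⁻¹' Set.Iio n)ᶜ).map w := by
    refine Measure.map_congr ((ae_restrict_iff' hE.compl).2 (Eventually.of_forall fun x hx => ?_))
    have hx' : ¬ κ x < n := hx
    simp [θ, hx']
  refine ⟨θ, hθ, fun x => ?_, ?_, fun j hj => ?_⟩
  · simp only [θ]
    split_ifs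
    · exact hu0 _ x
    · exact hα0.le.trans (hw0 x)
  · have hdecomp : κ ⁻¹' Set.Iio n = ⋃ j ∈ Finset.range n, κ ⁻¹' {j} := by
      ext x
      simp
    have hdisj : ∀ B : Set X, (Finset.range n : Set ℕ).PairwiseDisjoint fun j => B ∩ κ ⁻¹' {j} := by
      intro B i _ j _ hij
      refine Disjoint.mono Set.inter_subset_right Set.inter_subset_right ?_
      exact Disjoint.preimage κ (by simpa using hij)
    have hsum : ∑ j ∈ Finset.range n, μ (κ ⁻¹' {j}) = ENNReal.ofReal α := by
      rw [← hα, hdecomp, measure_biUnion_finset (by simpa using hdisj Set.univ) fun j _ => hS j]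
    have h1 : (μ.restrict (κ ⁻¹' Set.Iio n)).map θ = volume.restrict (Set.Ioc 0 α) := by
      ext B hB
      have hpre : θ ⁻¹' B ∩ κ ⁻¹' Set.Iio n = ⋃ j ∈ Finset.range n, θ ⁻¹' B ∩ κ ⁻¹' {j} := by
        rw [hdecomp, Set.inter_iUnion₂]
      rw [Measure.map_apply hθ hB, Measure.restrict_apply (hθ hB), hpre,
        measure_biUnion_finset (hdisj _) fun j _ => (hθ hB).inter (hS j)]
      have hterm : ∀ j ∈ Finset.range n, μ (θ ⁻¹' B ∩ κ ⁻¹' {j}) =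
          μ (κ ⁻¹' {j}) * ((ENNReal.ofReal α)⁻¹ * volume.restrict (Set.Ioc 0 α) B) := by
        intro j hj
        rw [← Measure.restrict_apply (hθ hB), ← Measure.map_apply hθ hB,
          hθu j (Finset.mem_range.1 hj), humap j, Measure.smul_apply, smul_eq_mul, sub_zero,
          mul_assoc]
      rw [Finset.sum_congr rfl hterm, ← Finset.sum_mul, hsum, ← mul_assoc,
        ENNReal.mul_inv_cancel (ENNReal.ofReal_pos.2 hα0).ne' ENNReal.ofReal_ne_top, one_mul]
    have h2 : μ (κ ⁻¹' Set.Iio n)ᶜ = ENNReal.ofReal (1 - α) := by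
      rw [prob_compl_eq_one_sub hE, hα, ENNReal.ofReal_sub 1 hα0.le, ENNReal.ofReal_one]
    have h3 : (μ.restrict (κ ⁻¹' Set.Iio n)ᶜ).map θ = volume.restrict (Set.Ioc α 1) := by
      rw [hθw, hwmap, h2, ENNReal.mul_inv_cancel (ENNReal.ofReal_pos.2 (sub_pos.2 hα1)).ne'
        ENNReal.ofReal_ne_top, one_smul]
    rw [← Measure.restrict_add_restrict_compl hE (μ := μ), Measure.map_add _ _ hθ, h1, h3,
      ← Measure.restrict_union (Set.Ioc_disjoint_Ioc_of_le le_rfl) measurableSet_Ioc,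
      Set.Ioc_union_Ioc_eq_Ioc hα0.le hα1.le]
  · rw [hθu j hj, humap j, sub_zero]

/-- The first pieces of a fine partition have total measure close to a prescribed number. -/
theorem exists_measure_preimage_Iio_mem {μ : Measure X} [IsProbabilityMeasure μ] {κ : X → ℕ}
    {β α : ℝ} (hβα : β < α) (hα : α ≤ 1)
    (hsmall : ∀ j, μ.real (κ ⁻¹' {j}) < α - β) (hβ : 0 < β) :
    ∃ n, β < μ.real (κ ⁻¹' Set.Iio n) ∧ μ.real (κ ⁻¹' Set.Iio n) < α := by
  classical
  have hlim : Tendsto (fun n => μ.real (κ ⁻¹' Set.Iio n)) atTop (𝓝 1) := by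
    have hU : ⋃ n, κ ⁻¹' Set.Iio n = Set.univ := by
      ext x
      simpa using ⟨κ x + 1, Nat.lt_succ_self _⟩
    have := tendsto_measure_iUnion_atTop (μ := μ) (s := fun n => κ ⁻¹' Set.Iio n)
      fun i j hij => Set.preimage_mono (Set.Iio_subset_Iio hij)
    rw [hU] at this
    have h2 := (ENNReal.tendsto_toReal (measure_ne_top μ Set.univ)).comp this
    simpa [Measure.real, Function.comp_def] using h2
  have hex : ∃ n, β < μ.real (κ ⁻¹' Set.Iio n) :=
    (hlim.eventually (lt_mem_nhds (hβα.trans_le hα))).exists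
  -- The first partial sum above β overshoots by less than one piece, hence by less than α - β.
  refine ⟨Nat.find hex, Nat.find_spec hex, ?_⟩
  rcases hn : Nat.find hex with _ | m
  · simpa using hβ.trans hβα
  · have hm : μ.real (κ ⁻¹' Set.Iio m) ≤ β :=
      not_lt.1 (Nat.find_min hex (by rw [hn]; exact Nat.lt_succ_self m))
    have hsplit : κ ⁻¹' Set.Iio (m + 1) = κ ⁻¹' Set.Iio m ∪ κ ⁻¹' {m} := by
      ext x
      simp [le_iff_lt_or_eq]
    have := measureReal_union_le (μ := μ) (κ ⁻¹' Set.Iio m) (κ ⁻¹' {m})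
    rw [hsplit]
    linarith [hsmall m]

/-! ### Decreasing profiles on (0, 1] -/

/-- A decreasing function on `(0, 1]`: a power near the origin followed by two steps. -/
noncomputable def stepPow (c e ε s a b x : ℝ) : ℝ :=
  if x ≤ ε then c * x ^ e else if x ≤ s then a else b

section stepPow

variable {c e ε s a b t : ℝ}

theorem measurable_stepPow (c e ε s a b : ℝ) : Measurable (stepPow c e ε s a b) := by
  refine Measurable.ite measurableSet_Iic (by fun_prop) ?_
  exact Measurable.ite measurableSet_Iic measurable_const measurable_const

theorem intervalIntegrable_stepPow_left (he : -1 < e) (ht0 : 0 ≤ t) (ht : t ≤ ε) :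
    IntervalIntegrable (stepPow c e ε s a b) volume 0 t := by
  refine ((intervalIntegral.intervalIntegrable_rpow' he).const_mul c).congr fun x hx => ?_
  rw [Set.uIoc_of_le ht0] at hx
  simp [stepPow, hx.2.trans ht]

theorem integral_stepPow_left (he : -1 < e) (ht0 : 0 ≤ t) (ht : t ≤ ε) :
    ∫ x in (0 : ℝ)..t, stepPow c e ε s a b x = c * t ^ (e + 1) / (e + 1) := by
  have h1 : ∫ x in (0 : ℝ)..t, stepPow c e ε s a b x = ∫ x in (0 : ℝ)..t, c * x ^ e := by
    refine intervalIntegral.integral_congr fun x hx => ?_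
    rw [Set.uIcc_of_le ht0] at hx
    simp [stepPow, hx.2.trans ht]
  rw [h1, intervalIntegral.integral_const_mul, integral_rpow (Or.inl he),
    Real.zero_rpow (by linarith), sub_zero, mul_div_assoc]

theorem stepPow_eq_mid (h1 : ε ≤ t) (h2 : t ≤ s) :
    ∀ x ∈ Set.uIoc ε t, stepPow c e ε s a b x = a := by
  intro x hx
  rw [Set.uIoc_of_le h1] at hx
  simp [stepPow, hx.1, hx.2.trans h2]

theorem stepPow_eq_right (hεs : ε ≤ s) (h1 : s ≤ t) :
    ∀ x ∈ Set.uIoc s t, stepPow c e ε s a b x = b := by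
  intro x hx
  rw [Set.uIoc_of_le h1] at hx
  simp [stepPow, not_le.2 hx.1, not_le.2 (hεs.trans_lt hx.1)]

theorem intervalIntegrable_stepPow_mid (he : -1 < e) (hε : 0 ≤ ε) (h1 : ε ≤ t) (h2 : t ≤ s) :
    IntervalIntegrable (stepPow c e ε s a b) volume 0 t :=
  (intervalIntegrable_stepPow_left he hε le_rfl).trans
    ((intervalIntegrable_const (c := a)).congr fun x hx => (stepPow_eq_mid h1 h2 x hx).symm)

theorem integral_stepPow_mid (he : -1 < e) (hε : 0 ≤ ε) (h1 : ε ≤ t) (h2 : t ≤ s) :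
    ∫ x in (0 : ℝ)..t, stepPow c e ε s a b x = c * ε ^ (e + 1) / (e + 1) + a * (t - ε) := by
  rw [← intervalIntegral.integral_add_adjacent_intervals
    (intervalIntegrable_stepPow_left he hε le_rfl)
    ((intervalIntegrable_const (c := a)).congr fun x hx => (stepPow_eq_mid h1 h2 x hx).symm),
    integral_stepPow_left he hε le_rfl, intervalIntegral.integral_congr_ae
      (Eventually.of_forall (stepPow_eq_mid h1 h2)), intervalIntegral.integral_const, smul_eq_mul,
    mul_comm a]

theorem integral_stepPow_right (he : -1 < e) (hε : 0 ≤ ε) (hεs : ε ≤ s) (h1 : s ≤ t) :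
    ∫ x in (0 : ℝ)..t, stepPow c e ε s a b x =
      c * ε ^ (e + 1) / (e + 1) + a * (s - ε) + b * (t - s) := by
  rw [← intervalIntegral.integral_add_adjacent_intervals
    (intervalIntegrable_stepPow_mid he hε hεs le_rfl)
    ((intervalIntegrable_const (c := b)).congr fun x hx => (stepPow_eq_right hεs h1 x hx).symm),
    integral_stepPow_mid he hε hεs le_rfl, intervalIntegral.integral_congr_ae
      (Eventually.of_forall (stepPow_eq_right hεs h1)), intervalIntegral.integral_const, smul_eq_mul,
    mul_comm b]

theorem stepPow_nonneg (hc : 0 ≤ c) (ha : 0 ≤ a) (hb : 0 ≤ b) {x : ℝ} (hx : 0 ≤ x) :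
    0 ≤ stepPow c e ε s a b x := by
  unfold stepPow
  split_ifs
  · positivity
  · exact ha
  · exact hb

theorem antitoneOn_stepPow (hc : 0 ≤ c) (he : e ≤ 0) (hab : b ≤ a) (ha : a ≤ c * ε ^ e) :
    AntitoneOn (stepPow c e ε s a b) (Set.Ioi 0) := by
  intro x hx y hy hxy
  have hx0 : 0 < x := hx
  have hpow : ∀ z, x ≤ z → c * z ^ e ≤ c * x ^ e := fun z hz =>
    mul_le_mul_of_nonneg_left (Real.rpow_le_rpow_of_nonpos hx0 hz he) hc
  unfold stepPow
  split_ifs with h1 h2 h3 h4 h5 h6 h7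
  · exact hpow y hxy
  all_goals first
    | linarith
    | linarith [hpow ε (by assumption)]

theorem stepPow_rpow (hc : 0 ≤ c) {x q : ℝ} (hx : 0 ≤ x) :
    stepPow c e ε s a b x ^ q = stepPow (c ^ q) (e * q) ε s (a ^ q) (b ^ q) x := by
  unfold stepPow
  split_ifs
  · rw [Real.mul_rpow hc (by positivity), ← Real.rpow_mul hx]
  · rfl
  · rfl

theorem stepPow_le_mul_rpow (he : e ≤ 0) (hc : 0 ≤ c) (ha : 0 ≤ a) (hb : 0 ≤ b) {x : ℝ}
    (hx : x ∈ Set.Ioc 0 1) : stepPow c e ε s a b x ≤ (c + a + b) * x ^ e := by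
  have h1 : 1 ≤ x ^ e := Real.one_le_rpow_of_pos_of_le_one_of_nonpos hx.1 hx.2 he
  unfold stepPow
  split_ifs <;> nlinarith

end stepPow

/-- `g` is a decreasing function on `(0, 1]` with integral `f` and average at least `l` over
`(0, α]`, whose integral over `(0, t]` is at most `F * t ^ r`, with equality near the origin. -/
structure IsProfile (F r f l α : ℝ) (g : ℝ → ℝ) : Prop where
  measurable : Measurable g
  nonneg : ∀ x, 0 ≤ x → 0 ≤ g x
  antitoneOn : AntitoneOn g (Set.Ioi 0)
  bound : ∃ D, 0 ≤ D ∧ ∀ x ∈ Set.Ioc 0 1, g x ≤ D * x ^ (r - 1)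
  integral_one : ∫ x in (0 : ℝ)..1, g x = f
  integral_le : ∀ t ∈ Set.Ioc (0 : ℝ) 1, ∫ x in (0 : ℝ)..t, g x ≤ F * t ^ r
  integral_eq : ∃ ε ∈ Set.Ioc (0 : ℝ) 1, ∀ t ∈ Set.Ioc 0 ε, ∫ x in (0 : ℝ)..t, g x = F * t ^ r
  le_integral : l * α ≤ ∫ x in (0 : ℝ)..α, g x

namespace IsProfile

variable {F r f l α : ℝ} {g g₀ g₁ : ℝ → ℝ}

theorem intervalIntegrable (h : IsProfile F r f l α g) (hr : 0 < r) {t : ℝ} (ht0 : 0 ≤ t)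
    (ht : t ≤ 1) : IntervalIntegrable g volume 0 t := by
  obtain ⟨D, -, hD⟩ := h.bound
  refine ((intervalIntegral.intervalIntegrable_rpow' (r := r - 1) (by linarith)).const_mul
    D).mono_fun' h.measurable.aestronglyMeasurable ?_
  rw [Set.uIoc_of_le ht0]
  filter_upwards [ae_restrict_mem measurableSet_Ioc] with x hx
  rw [Real.norm_of_nonneg (h.nonneg x hx.1.le)]
  exact hD x ⟨hx.1, hx.2.trans ht⟩

/-- Every condition is a linear equation or inequality in g; equality near the origin persists on
the shorter of the two intervals. -/
theorem convexComb (h₀ : IsProfile F r f l α g₀) (h₁ : IsProfile F r f l α g₁) (hr : 0 < r)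
    (hα0 : 0 ≤ α) (hα1 : α ≤ 1) {y : ℝ} (hy : y ∈ Set.Icc 0 1) :
    IsProfile F r f l α (fun x => (1 - y) * g₀ x + y * g₁ x) := by
  have hy' : 0 ≤ 1 - y := by linarith [hy.2]
  have hint : ∀ t, 0 ≤ t → t ≤ 1 → ∫ x in (0 : ℝ)..t, ((1 - y) * g₀ x + y * g₁ x) =
      (1 - y) * (∫ x in (0 : ℝ)..t, g₀ x) + y * ∫ x in (0 : ℝ)..t, g₁ x := by
    intro t ht0 ht1
    rw [intervalIntegral.integral_add ((h₀.intervalIntegrable hr ht0 ht1).const_mul _)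
      ((h₁.intervalIntegrable hr ht0 ht1).const_mul _), intervalIntegral.integral_const_mul,
      intervalIntegral.integral_const_mul]
  refine ⟨(h₀.measurable.const_mul _).add (h₁.measurable.const_mul _), fun x hx => ?_,
    fun a ha b hb hab => ?_, ?_, ?_, fun t ht => ?_, ?_, ?_⟩
  · exact add_nonneg (mul_nonneg hy' (h₀.nonneg x hx)) (mul_nonneg hy.1 (h₁.nonneg x hx))
  · exact add_le_add (mul_le_mul_of_nonneg_left (h₀.antitoneOn ha hb hab) hy')
      (mul_le_mul_of_nonneg_left (h₁.antitoneOn ha hb hab) hy.1)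
  · obtain ⟨D₀, hD₀, hb₀⟩ := h₀.bound
    obtain ⟨D₁, hD₁, hb₁⟩ := h₁.bound
    refine ⟨(1 - y) * D₀ + y * D₁, add_nonneg (mul_nonneg hy' hD₀) (mul_nonneg hy.1 hD₁),
      fun x hx => ?_⟩
    rw [add_mul, mul_assoc, mul_assoc]
    exact add_le_add (mul_le_mul_of_nonneg_left (hb₀ x hx) hy')
      (mul_le_mul_of_nonneg_left (hb₁ x hx) hy.1)
  · rw [hint 1 zero_le_one le_rfl, h₀.integral_one, h₁.integral_one]
    ring
  · rw [hint t ht.1.le ht.2]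
    have := mul_le_mul_of_nonneg_left (h₀.integral_le t ht) hy'
    have := mul_le_mul_of_nonneg_left (h₁.integral_le t ht) hy.1
    linarith
  · obtain ⟨ε₀, hε₀, he₀⟩ := h₀.integral_eq
    obtain ⟨ε₁, hε₁, he₁⟩ := h₁.integral_eq
    refine ⟨min ε₀ ε₁, ⟨lt_min hε₀.1 hε₁.1, (min_le_left _ _).trans hε₀.2⟩, fun t ht => ?_⟩
    have ht0 : t ≤ ε₀ := ht.2.trans (min_le_left _ _)
    rw [hint t ht.1.le (ht0.trans hε₀.2), he₀ t ⟨ht.1, ht0⟩,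
      he₁ t ⟨ht.1, ht.2.trans (min_le_right _ _)⟩]
    ring
  · rw [hint α hα0 hα1]
    have := mul_le_mul_of_nonneg_left h₀.le_integral hy'
    have := mul_le_mul_of_nonneg_left h₁.le_integral hy.1
    linarith

theorem intervalIntegrable_rpow (h : IsProfile F r f l α g) {q : ℝ} (hq : 0 ≤ q)
    (hrq : -1 < (r - 1) * q) : IntervalIntegrable (fun x => g x ^ q) volume 0 1 := by
  obtain ⟨D, hD0, hD⟩ := h.bound
  refine ((intervalIntegral.intervalIntegrable_rpow' hrq).const_mul (D ^ q)).mono_fun'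
    (h.measurable.pow_const q).aestronglyMeasurable ?_
  rw [Set.uIoc_of_le zero_le_one]
  filter_upwards [ae_restrict_mem measurableSet_Ioc] with x hx
  have h0 := h.nonneg x hx.1.le
  rw [Real.norm_of_nonneg (by positivity), Real.rpow_mul hx.1.le,
    ← Real.mul_rpow hD0 (Real.rpow_nonneg hx.1.le _)]
  exact Real.rpow_le_rpow h0 (hD x hx) hq

/-- The q-integral is continuous along the segment from g₀ to g₁, by dominated convergence with an
integrable power as bound. -/
theorem exists_integral_rpow_eq (h₀ : IsProfile F r f l α g₀) (h₁ : IsProfile F r f l α g₁)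
    (hr : 0 < r) (hα0 : 0 ≤ α) (hα1 : α ≤ 1) {q A : ℝ} (hq : 0 < q) (hrq : -1 < (r - 1) * q)
    (hA₀ : ∫ x in (0 : ℝ)..1, g₀ x ^ q ≤ A) (hA₁ : A ≤ ∫ x in (0 : ℝ)..1, g₁ x ^ q) :
    ∃ g, IsProfile F r f l α g ∧ ∫ x in (0 : ℝ)..1, g x ^ q = A := by
  obtain ⟨D₀, hD₀, hb₀⟩ := h₀.bound
  obtain ⟨D₁, hD₁, hb₁⟩ := h₁.bound
  have hcont : ContinuousOn (fun y => ∫ x in (0 : ℝ)..1, ((1 - y) * g₀ x + y * g₁ x) ^ q)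
      (Set.Icc 0 1) := by
    simp only [intervalIntegral.integral_of_le zero_le_one]
    refine continuousOn_of_dominated (bound := fun x => (D₀ + D₁) ^ q * x ^ ((r - 1) * q))
      (fun y hy => ?_) (fun y hy => ?_) ?_ ?_
    · exact ((h₀.convexComb h₁ hr hα0 hα1 hy).measurable.pow_const q).aestronglyMeasurable
    · filter_upwards [ae_restrict_mem measurableSet_Ioc] with x hx
      have h0 := (h₀.convexComb h₁ hr hα0 hα1 hy).nonneg x hx.1.le
      have hx' : 0 ≤ x ^ (r - 1) := Real.rpow_nonneg hx.1.le _
      rw [Real.norm_of_nonneg (by positivity), Real.rpow_mul hx.1.le,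
        ← Real.mul_rpow (by positivity) hx']
      refine Real.rpow_le_rpow h0 ?_ hq.le
      have a1 : (1 - y) * g₀ x ≤ 1 * g₀ x :=
        mul_le_mul_of_nonneg_right (by linarith [hy.1]) (h₀.nonneg x hx.1.le)
      have a2 : y * g₁ x ≤ 1 * g₁ x := mul_le_mul_of_nonneg_right hy.2 (h₁.nonneg x hx.1.le)
      linarith [hb₀ x hx, hb₁ x hx]
    · exact ((intervalIntegral.intervalIntegrable_rpow' hrq).const_mul _).1
    · refine Eventually.of_forall fun x => Continuous.continuousOn ?_
      exact Continuous.rpow_const (by fun_prop) fun _ => Or.inr hq.le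
  obtain ⟨y, hy, hyA⟩ := intermediate_value_Icc zero_le_one hcont
    (show A ∈ Set.Icc _ _ from ⟨by simpa using hA₀, by simpa using hA₁⟩)
  exact ⟨_, h₀.convexComb h₁ hr hα0 hα1 hy, hyA⟩

end IsProfile

/-- A concave function minus an affine one is at least the smaller of its endpoint values. -/
theorem affine_le_mul_rpow {F r t₁ t₂ t y a : ℝ} (hF : 0 ≤ F) (hr0 : 0 ≤ r) (hr1 : r ≤ 1)
    (ht₁ : 0 ≤ t₁) (h₁ : y ≤ F * t₁ ^ r) (h₂ : y + a * (t₂ - t₁) ≤ F * t₂ ^ r)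
    (ht : t ∈ Set.Icc t₁ t₂) : y + a * (t - t₁) ≤ F * t ^ r := by
  have hconc : ConcaveOn ℝ (Set.Ici 0) fun x : ℝ => F * x ^ r - (y + a * (x - t₁)) := by
    refine ((Real.concaveOn_rpow hr0 hr1).smul hF).sub ?_
    refine ⟨convex_Ici 0, fun u _ v _ m n _ _ hmn => le_of_eq ?_⟩
    simp only [smul_eq_mul]
    linear_combination (y - a * t₁) * (-hmn)
  have := hconc.min_le_of_mem_Icc (x := t₁) (y := t₂) ht₁ (ht₁.trans (ht.1.trans ht.2)) ht
  have h3 : 0 ≤ min (F * t₁ ^ r - (y + a * (t₁ - t₁))) (F * t₂ ^ r - (y + a * (t₂ - t₁))) :=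
    le_min (by linarith) (by linarith)
  linarith

/-- The primitive is F t^r up to ε and then affine on two intervals, so concavity reduces the bound
by F t^r to the breakpoints s and 1. -/
theorem isProfile_stepPow {F r f l α ε s a b : ℝ} (hF : 0 ≤ F) (hr0 : 0 < r) (hr1 : r < 1)
    (hε : 0 < ε) (hεs : ε ≤ s) (hs1 : s ≤ 1) (hb : 0 ≤ b) (hab : b ≤ a)
    (ha : a ≤ F * r * ε ^ (r - 1)) (hs : F * ε ^ r + a * (s - ε) ≤ F * s ^ r)
    (hf : F * ε ^ r + a * (s - ε) + b * (1 - s) = f) (hfF : f ≤ F)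
    (hα : l * α ≤ ∫ x in (0 : ℝ)..α, stepPow (F * r) (r - 1) ε s a b x) :
    IsProfile F r f l α (stepPow (F * r) (r - 1) ε s a b) := by
  have he : -1 < r - 1 := by linarith
  have hc : 0 ≤ F * r := by positivity
  have hsimp : ∀ t : ℝ, F * r * t ^ (r - 1 + 1) / (r - 1 + 1) = F * t ^ r := by
    intro t
    rw [sub_add_cancel]
    field_simp
  refine ⟨measurable_stepPow _ _ _ _ _ _, fun x hx => stepPow_nonneg hc (hb.trans hab) hb hx,
    antitoneOn_stepPow hc (by linarith) hab ha,
    ⟨F * r + a + b, by linarith, fun x hx =>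
      stepPow_le_mul_rpow (by linarith) hc (hb.trans hab) hb hx⟩, ?_, fun t ht => ?_,
    ⟨ε, ⟨hε, hεs.trans hs1⟩, fun t ht => ?_⟩, hα⟩
  · rw [integral_stepPow_right he hε.le hεs hs1, hsimp, hf]
  · rcases le_total t ε with h1 | h1
    · rw [integral_stepPow_left he ht.1.le h1, hsimp]
    rcases le_total t s with h2 | h2
    · rw [integral_stepPow_mid he hε.le h1 h2, hsimp]
      exact affine_le_mul_rpow hF hr0.le hr1.le hε.le le_rfl hs ⟨h1, h2⟩
    · rw [integral_stepPow_right he hε.le hεs h2, hsimp]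
      refine affine_le_mul_rpow hF hr0.le hr1.le (hε.le.trans hεs) hs ?_ ⟨h2, ht.2⟩
      rw [hf, Real.one_rpow, mul_one]
      exact hfF
  · rw [integral_stepPow_left he ht.1.le ht.2, hsimp]

theorem integral_stepPow_rpow {c e ε s a b q : ℝ} (hc : 0 ≤ c) (heq : -1 < e * q) (hε : 0 ≤ ε)
    (hεs : ε ≤ s) (hs1 : s ≤ 1) :
    ∫ x in (0 : ℝ)..1, stepPow c e ε s a b x ^ q =
      c ^ q * ε ^ (e * q + 1) / (e * q + 1) + a ^ q * (s - ε) + b ^ q * (1 - s) := by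
  rw [← integral_stepPow_right heq hε hεs hs1]
  refine intervalIntegral.integral_congr fun x hx => ?_
  rw [Set.uIcc_of_le zero_le_one] at hx
  exact stepPow_rpow hc hx.1

/-- The profile with the largest power integrals: a power cut off at the level of total mass
`f`. -/
theorem exists_isProfile_max {F r f l α q : ℝ} (hf : 0 < f) (hfF : f ≤ F) (hr0 : 0 < r)
    (hr1 : r < 1) (hq : q ≠ 0) (hrq : -1 < (r - 1) * q) (hα0 : 0 < α) (hlf : l * α ≤ f)
    (hlF : l * α ≤ F * α ^ r) :
    ∃ g, IsProfile F r f l α g ∧ ∫ x in (0 : ℝ)..1, g x ^ q =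
      (F * r) ^ q * ((f / F) ^ r⁻¹) ^ ((r - 1) * q + 1) / ((r - 1) * q + 1) := by
  have hF : 0 < F := hf.trans_le hfF
  -- Chosen so that F ε^r = f: the power alone carries the whole mass.
  set ε := (f / F) ^ r⁻¹ with hε
  have hε0 : 0 < ε := by positivity
  have hε1 : ε ≤ 1 := Real.rpow_le_one (by positivity) ((div_le_one hF).2 hfF) (by positivity)
  have hεr : F * ε ^ r = f := by
    rw [hε, ← Real.rpow_mul (by positivity), inv_mul_cancel₀ hr0.ne', Real.rpow_one]
    field_simp
  have he : -1 < r - 1 := by linarith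
  have hsimp : ∀ t : ℝ, F * r * t ^ (r - 1 + 1) / (r - 1 + 1) = F * t ^ r := by
    intro t
    rw [sub_add_cancel]
    field_simp
  refine ⟨stepPow (F * r) (r - 1) ε ε 0 0, isProfile_stepPow hF.le hr0 hr1 hε0 le_rfl hε1 le_rfl
    le_rfl (by positivity) (by simp) (by simp [hεr]) hfF ?_, ?_⟩
  · rcases le_total α ε with h | h
    · rw [integral_stepPow_left he hα0.le h, hsimp]
      exact hlF
    · rw [integral_stepPow_right he hε0.le le_rfl h, hsimp, hεr]
      simpa using hlf
  · rw [integral_stepPow_rpow (by positivity) hrq hε0.le le_rfl hε1, Real.zero_rpow hq]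
    simp

/-- A profile whose power integral is close to the smallest possible one. -/
theorem exists_isProfile_lt {F r f l α q A : ℝ} (hf : 0 < f) (hfF : f ≤ F) (hr0 : 0 < r)
    (hr1 : r < 1) (hrq : -1 < (r - 1) * q) (hα0 : 0 < α) (hα1 : α < 1) (hfl : f < l)
    (hlf : l * α ≤ f) (hlF : l * α < F * α ^ r)
    (hA : l ^ q * α + ((f - l * α) / (1 - α)) ^ q * (1 - α) < A) :
    ∃ g, IsProfile F r f l α g ∧ ∫ x in (0 : ℝ)..1, g x ^ q < A := by
  have hF : 0 < F := hf.trans_le hfF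
  have hα1' : 0 < 1 - α := by linarith
  set c := (f - l * α) / (1 - α) with hc
  have hc0 : 0 ≤ c := div_nonneg (by linarith) hα1'.le
  have hcf : l * α + c * (1 - α) = f := by
    rw [hc]
    field_simp
    ring
  have hcl : c < l := by
    rw [hc, div_lt_iff₀ hα1']
    linarith
  have hlc : 0 < l - c := by linarith
  -- The solution of F ε^r + l (s - ε) + c (1 - s) = f: the excess mass of the spike over height l
  -- is paid for by ending the step of height l before α.
  set s : ℝ → ℝ := fun ε => α - (F * ε ^ r - l * ε) / (l - c) with hs
  have hcr : ∀ k : ℝ, 0 < k → ContinuousAt (fun ε : ℝ => ε ^ k) 0 := fun k hk =>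
    Real.continuousAt_rpow_const 0 k (Or.inr hk.le)
  have hscont : ContinuousAt s 0 := by
    have := hcr r hr0
    fun_prop
  have hs0 : s 0 = α := by simp [hs, Real.zero_rpow hr0.ne']
  -- All requirements are strict in the limit ε = 0, s = α, hence hold for small ε > 0.
  have e1 : ∀ᶠ ε in 𝓝[>] (0 : ℝ), l * ε ^ (1 - r) < F * r := by
    have h1 : ContinuousAt (fun ε : ℝ => l * ε ^ (1 - r)) 0 := by
      have := hcr (1 - r) (by linarith)
      fun_prop
    refine nhdsWithin_le_nhds (h1.eventually_lt continuousAt_const ?_)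
    rw [Real.zero_rpow (by linarith), mul_zero]
    positivity
  have e2 : ∀ᶠ ε in 𝓝[>] (0 : ℝ), ε < s ε :=
    nhdsWithin_le_nhds (continuousAt_id.eventually_lt hscont (by simpa [hs0] using hα0))
  have e3 : ∀ᶠ ε in 𝓝[>] (0 : ℝ), l * α - c * (α - s ε) < F * s ε ^ r := by
    have h1 : ContinuousAt (fun ε => F * s ε ^ r) 0 :=
      continuousAt_const.mul (hscont.rpow_const (Or.inr hr0.le))
    refine nhdsWithin_le_nhds (ContinuousAt.eventually_lt (by fun_prop) h1 ?_)
    simpa [hs0] using hlF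
  have e4 : ∀ᶠ ε in 𝓝[>] (0 : ℝ), (F * r) ^ q * ε ^ ((r - 1) * q + 1) / ((r - 1) * q + 1) +
      l ^ q * (s ε - ε) + c ^ q * (1 - s ε) < A := by
    have h1 := hcr ((r - 1) * q + 1) (by linarith)
    refine nhdsWithin_le_nhds (ContinuousAt.eventually_lt (by fun_prop) continuousAt_const ?_)
    rw [Real.zero_rpow (by linarith), hs0]
    simpa using hA
  obtain ⟨ε, h1, h2, h3, h4, hε⟩ :=
    (e1.and (e2.and (e3.and (e4.and self_mem_nhdsWithin)))).exists
  have hε : 0 < ε := hε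
  have hle : l ≤ F * r * ε ^ (r - 1) := by
    have h5 : ε ^ (1 - r) * ε ^ (r - 1) = 1 := by
      rw [← Real.rpow_add hε, sub_add_sub_cancel, sub_self, Real.rpow_zero]
    calc l = l * ε ^ (1 - r) * ε ^ (r - 1) := by rw [mul_assoc, h5, mul_one]
      _ ≤ F * r * ε ^ (r - 1) := by gcongr
  have hη : l * ε ≤ F * ε ^ r := by
    have h5 : ε ^ (r - 1) * ε = ε ^ r := by
      rw [← Real.rpow_add_one hε.ne', sub_add_cancel]
    calc l * ε ≤ F * r * ε ^ (r - 1) * ε := by gcongr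
      _ = F * ε ^ r * r := by rw [mul_assoc, h5]; ring
      _ ≤ F * ε ^ r * 1 := by gcongr
      _ = F * ε ^ r := mul_one _
  have hsα : s ε ≤ α := by
    have : 0 ≤ (F * ε ^ r - l * ε) / (l - c) := div_nonneg (by linarith) hlc.le
    simp only [hs]
    linarith
  have hmass : F * ε ^ r + l * (s ε - ε) = l * α - c * (α - s ε) := by
    simp only [hs]
    field_simp
    ring
  have he : -1 < r - 1 := by linarith
  have hsimp : ∀ t : ℝ, F * r * t ^ (r - 1 + 1) / (r - 1 + 1) = F * t ^ r := by
    intro t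
    rw [sub_add_cancel]
    field_simp
  refine ⟨stepPow (F * r) (r - 1) ε (s ε) l c, isProfile_stepPow hF.le hr0 hr1 hε h2.le
    (hsα.trans hα1.le) hc0 hcl.le hle (by rw [hmass]; exact h3.le) ?_ hfF ?_, ?_⟩
  · rw [hmass]
    linarith
  · rw [integral_stepPow_right he hε.le h2.le hsα, hsimp, hmass]
    linarith
  · rwa [integral_stepPow_rpow (by positivity) hrq hε.le h2.le (hsα.trans hα1.le)]

/-! ### From profiles to functions on X -/

theorem lintegral_enorm_eq_ofReal {μ : Measure X} {φ : X → ℝ} (h0 : ∀ x, 0 ≤ φ x)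
    (hφ : Integrable φ μ) (E : Set X) :
    ∫⁻ x in E, ‖φ x‖ₑ ∂μ = ENNReal.ofReal (∫ x in E, φ x ∂μ) := by
  rw [ofReal_integral_eq_lintegral_ofReal hφ.integrableOn (Eventually.of_forall h0)]
  exact lintegral_congr fun x => Real.enorm_of_nonneg (h0 x)

theorem weakNorm_term_eq {μ : Measure X} [IsFiniteMeasure μ] {φ : X → ℝ} (h0 : ∀ x, 0 ≤ φ x)
    (hφ : Integrable φ μ) (p : ℝ) {E : Set X} (hE : 0 < μ E) :
    μ E ^ (-1 + 1 / p) * ∫⁻ x in E, ‖φ x‖ₑ ∂μ =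
      ENNReal.ofReal (μ.real E ^ (-1 + 1 / p) * ∫ x in E, φ x ∂μ) := by
  have hpos : 0 < μ.real E := ENNReal.toReal_pos hE.ne' (measure_ne_top μ E)
  rw [lintegral_enorm_eq_ofReal h0 hφ, ENNReal.ofReal_mul (by positivity),
    ← ENNReal.ofReal_rpow_of_pos hpos, ofReal_measureReal]

theorem rpow_mul_le_iff {t p y F : ℝ} (ht : 0 < t) :
    t ^ (-1 + 1 / p) * y ≤ F ↔ y ≤ F * t ^ (1 - 1 / p) := by
  have h : t ^ (-1 + 1 / p) = (t ^ (1 - 1 / p))⁻¹ := by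
    rw [← Real.rpow_neg ht.le]
    congr 1
    ring
  rw [h, inv_mul_le_iff₀ (by positivity), mul_comm F]

theorem setIntegral_le_of_weakNorm_le {μ : Measure X} [IsFiniteMeasure μ] {φ : X → ℝ}
    (h0 : ∀ x, 0 ≤ φ x) (hφ : Integrable φ μ) {p F : ℝ} (hF : 0 ≤ F)
    (hw : weakNorm μ p φ ≤ ENNReal.ofReal F) {E : Set X} (hE : MeasurableSet E)
    (hpos : 0 < μ E) : ∫ x in E, φ x ∂μ ≤ F * μ.real E ^ (1 - 1 / p) := by
  have hterm : μ E ^ (-1 + 1 / p) * ∫⁻ x in E, ‖φ x‖ₑ ∂μ ≤ weakNorm μ p φ :=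
    le_iSup_of_le E (le_iSup_of_le hE (le_iSup_of_le hpos le_rfl))
  have h1 := hterm.trans hw
  rw [weakNorm_term_eq h0 hφ p hpos, ENNReal.ofReal_le_ofReal_iff hF] at h1
  exact (rpow_mul_le_iff (ENNReal.toReal_pos hpos.ne' (measure_ne_top μ E))).1 h1

theorem weakNorm_le_of_setIntegral_le {μ : Measure X} [IsFiniteMeasure μ] {φ : X → ℝ}
    (h0 : ∀ x, 0 ≤ φ x) (hφ : Integrable φ μ) {p F : ℝ}
    (h : ∀ E, MeasurableSet E → 0 < μ E → ∫ x in E, φ x ∂μ ≤ F * μ.real E ^ (1 - 1 / p)) :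
    weakNorm μ p φ ≤ ENNReal.ofReal F := by
  refine iSup_le fun E => iSup_le fun hE => iSup_le fun hpos => ?_
  rw [weakNorm_term_eq h0 hφ p hpos]
  exact ENNReal.ofReal_le_ofReal
    ((rpow_mul_le_iff (ENNReal.toReal_pos hpos.ne' (measure_ne_top μ E))).2 (h E hE hpos))

section uniform

variable {μ : Measure X} {θ : X → ℝ} {F r f l α : ℝ} {g : ℝ → ℝ}

theorem integrable_comp_uniform (hθ : Measurable θ)
    (hmap : μ.map θ = volume.restrict (Set.Ioc 0 1)) {g : ℝ → ℝ}
    (hg : IntervalIntegrable g volume 0 1) : Integrable (fun x => g (θ x)) μ := by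
  have h : Integrable g (μ.map θ) := by
    rw [hmap]
    exact hg.1
  exact h.comp_measurable hθ

theorem integral_comp_uniform (hθ : Measurable θ)
    (hmap : μ.map θ = volume.restrict (Set.Ioc 0 1)) {g : ℝ → ℝ}
    (hg : Measurable g) : ∫ x, g (θ x) ∂μ = ∫ x in (0 : ℝ)..1, g x := by
  rw [intervalIntegral.integral_of_le zero_le_one, ← hmap,
    integral_map hθ.aemeasurable hg.aestronglyMeasurable]

theorem measure_preimage_Iic_uniform (hθ : Measurable θ)
    (hmap : μ.map θ = volume.restrict (Set.Ioc 0 1)) {t : ℝ} (ht1 : t ≤ 1) :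
    μ (θ ⁻¹' Set.Iic t) = ENNReal.ofReal t := by
  rw [← Measure.map_apply hθ measurableSet_Iic, hmap, Measure.restrict_apply measurableSet_Iic]
  have : Set.Iic t ∩ Set.Ioc (0 : ℝ) 1 = Set.Ioc 0 t := by
    ext y
    simp only [Set.mem_inter_iff, Set.mem_Iic, Set.mem_Ioc]
    exact ⟨fun hy => ⟨hy.2.1, hy.1⟩, fun hy => ⟨hy.2, hy.1, hy.2.trans ht1⟩⟩
  rw [this, Real.volume_Ioc, sub_zero]

theorem setIntegral_preimage_Iic_uniform (hθ : Measurable θ)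
    (hmap : μ.map θ = volume.restrict (Set.Ioc 0 1)) {g : ℝ → ℝ} (hg : Measurable g) {t : ℝ}
    (ht0 : 0 ≤ t) (ht1 : t ≤ 1) :
    ∫ x in θ ⁻¹' Set.Iic t, g (θ x) ∂μ = ∫ x in (0 : ℝ)..t, g x := by
  have : Set.Iic t ∩ Set.Ioc (0 : ℝ) 1 = Set.Ioc 0 t := by
    ext y
    simp only [Set.mem_inter_iff, Set.mem_Iic, Set.mem_Ioc]
    exact ⟨fun hy => ⟨hy.2.1, hy.1⟩, fun hy => ⟨hy.2, hy.1, hy.2.trans ht1⟩⟩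
  rw [← setIntegral_map measurableSet_Iic hg.aestronglyMeasurable hθ.aemeasurable, hmap,
    Measure.restrict_restrict measurableSet_Iic, this, intervalIntegral.integral_of_le ht0]

/-- Among the sets of measure `t`, the integral of a decreasing profile is largest over
`{θ ≤ t}`. -/
theorem IsProfile.setIntegral_comp_le [IsProbabilityMeasure μ]
    (h : IsProfile F r f l α g) (hr : 0 < r)
    (hθ : Measurable θ) (hmap : μ.map θ = volume.restrict (Set.Ioc 0 1)) {E : Set X}
    (hpos : 0 < μ E) :
    ∫ x in E, g (θ x) ∂μ ≤ ∫ x in (0 : ℝ)..μ.real E, g x := by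
  set t := μ.real E with ht
  have ht0 : 0 < t := ENNReal.toReal_pos hpos.ne' (measure_ne_top μ E)
  have ht1 : t ≤ 1 := measureReal_le_one
  have hint := integrable_comp_uniform hθ hmap (h.intervalIntegrable hr zero_le_one le_rfl)
  have hint' : Integrable (fun x => max (g (θ x) - g t) 0) μ :=
    (hint.sub (integrable_const _)).pos_part
  have hE : μ.real (θ ⁻¹' Set.Iic t) = t := by
    rw [Measure.real, measure_preimage_Iic_uniform hθ hmap ht1, ENNReal.toReal_ofReal ht0.le]
  -- Bathtub argument: subtracting the level g(t) changes the integrals over E and over {θ ≤ t}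
  -- equally, and by monotonicity the positive part lives on {θ ≤ t}.
  have h1 : ∫ x in E, (g (θ x) - g t) ∂μ ≤ ∫ x, max (g (θ x) - g t) 0 ∂μ := by
    calc ∫ x in E, (g (θ x) - g t) ∂μ ≤ ∫ x in E, max (g (θ x) - g t) 0 ∂μ :=
          integral_mono (hint.sub (integrable_const _)).integrableOn hint'.integrableOn
            fun x => le_max_left _ _
      _ ≤ ∫ x, max (g (θ x) - g t) 0 ∂μ :=
          setIntegral_le_integral hint' (Eventually.of_forall fun x => le_max_right _ _)
  have hae : ∀ᵐ x ∂μ, 0 < θ x := by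
    have : ∀ᵐ y ∂(μ.map θ), 0 < y := by
      rw [hmap]
      filter_upwards [ae_restrict_mem measurableSet_Ioc] with y hy using hy.1
    exact ae_of_ae_map hθ.aemeasurable this
  have h2 : ∫ x, max (g (θ x) - g t) 0 ∂μ = ∫ x in θ ⁻¹' Set.Iic t, (g (θ x) - g t) ∂μ := by
    rw [← integral_indicator (hθ measurableSet_Iic)]
    refine integral_congr_ae ?_
    filter_upwards [hae] with x hx
    by_cases hxt : θ x ≤ t
    · rw [Set.indicator_of_mem (show x ∈ θ ⁻¹' Set.Iic t from hxt)]
      exact max_eq_left (sub_nonneg.2 (h.antitoneOn hx ht0 hxt))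
    · rw [Set.indicator_of_notMem (show x ∉ θ ⁻¹' Set.Iic t from hxt)]
      exact max_eq_right (sub_nonpos.2 (h.antitoneOn ht0 hx (not_le.1 hxt).le))
  rw [h2, integral_sub hint.integrableOn (integrable_const _),
    integral_sub hint.integrableOn (integrable_const _),
    setIntegral_preimage_Iic_uniform hθ hmap h.measurable ht0.le ht1] at h1
  simp only [setIntegral_const, hE, ← ht] at h1
  linarith

theorem IsProfile.comp_mem_classLqWeak [IsProbabilityMeasure μ] {p q A : ℝ} (hr : 0 < 1 - 1 / p)
    (hq : 0 ≤ q) (hrq : -1 < (1 - 1 / p - 1) * q)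
    (h : IsProfile F (1 - 1 / p) f l α g) (hA : ∫ x in (0 : ℝ)..1, g x ^ q = A)
    (hθ : Measurable θ) (hθ0 : ∀ x, 0 ≤ θ x)
    (hmap : μ.map θ = volume.restrict (Set.Ioc 0 1)) :
    (fun x => g (θ x)) ∈ classLqWeak μ p q f A F := by
  have hint := integrable_comp_uniform hθ hmap (h.intervalIntegrable hr zero_le_one le_rfl)
  have h0 : ∀ x, 0 ≤ g (θ x) := fun x => h.nonneg _ (hθ0 x)
  refine ⟨⟨h0, hint, ?_, ?_, ?_⟩, le_antisymm ?_ ?_⟩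
  · rw [integral_comp_uniform hθ hmap h.measurable, h.integral_one]
  · exact integrable_comp_uniform hθ hmap (h.intervalIntegrable_rpow hq hrq)
  · rw [integral_comp_uniform hθ hmap (h.measurable.pow_const q), hA]
  · refine weakNorm_le_of_setIntegral_le h0 hint fun E _ hpos => ?_
    exact (h.setIntegral_comp_le hr hθ hmap hpos).trans (h.integral_le _
      ⟨ENNReal.toReal_pos hpos.ne' (measure_ne_top μ E), measureReal_le_one⟩)
  -- The set {θ ≤ ε} attains the value F.
  · obtain ⟨ε, hε, heq⟩ := h.integral_eq
    have hm : μ (θ ⁻¹' Set.Iic ε) = ENNReal.ofReal ε := measure_preimage_Iic_uniform hθ hmap hε.2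
    have hpos : 0 < μ (θ ⁻¹' Set.Iic ε) := by
      rw [hm]
      exact ENNReal.ofReal_pos.2 hε.1
    have hterm := weakNorm_term_eq h0 hint p hpos
    rw [setIntegral_preimage_Iic_uniform hθ hmap h.measurable hε.1.le hε.2,
      heq ε ⟨hε.1, le_rfl⟩, Measure.real, hm, ENNReal.toReal_ofReal hε.1.le] at hterm
    have hval : ε ^ (-1 + 1 / p) * (F * ε ^ (1 - 1 / p)) = F := by
      rw [mul_left_comm, ← Real.rpow_add hε.1]
      ring_nf
      simp
    rw [hval] at hterm
    rw [← hterm, ← hm]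
    exact le_iSup_of_le _ (le_iSup_of_le (hθ measurableSet_Iic) (le_iSup_of_le hpos le_rfl))

/-- The average of g ∘ θ over I equals the average of g over (0, α], which is at least l. -/
theorem IsProfile.le_maximal_comp [IsProbabilityMeasure μ]
    (h : IsProfile F r f l α g) (hr : 0 < r) (hα0 : 0 < α)
    (hα1 : α ≤ 1) {T : Set (Set X)} (hθ : Measurable θ) {I S : Set X}
    (hI : I ∈ T) (hSI : S ⊆ I) (hae : S =ᵐ[μ] I) (hpos : 0 < μ I)
    (hmap : (μ.restrict S).map θ =
      (μ S * (ENNReal.ofReal α)⁻¹) • volume.restrict (Set.Ioc 0 α)) {x : X} (hx : x ∈ S) :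
    ENNReal.ofReal l ≤ maximal μ T (fun x => g (θ x)) x := by
  have hlin : ∫⁻ y in I, ‖g (θ y)‖ₑ ∂μ =
      μ I * (ENNReal.ofReal α)⁻¹ * ENNReal.ofReal (∫ x in (0 : ℝ)..α, g x) := by
    rw [← setLIntegral_congr hae, ← lintegral_map h.measurable.enorm hθ, hmap,
      lintegral_smul_measure, smul_eq_mul, measure_congr hae,
      intervalIntegral.integral_of_le hα0.le, ofReal_integral_eq_lintegral_ofReal]
    · congr 1
      refine setLIntegral_congr_fun measurableSet_Ioc fun y hy => ?_
      exact Real.enorm_of_nonneg (h.nonneg y hy.1.le)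
    · exact (h.intervalIntegrable hr hα0.le hα1).1
    · filter_upwards [ae_restrict_mem measurableSet_Ioc] with y hy
      exact h.nonneg y hy.1.le
  have hα' : ENNReal.ofReal α ≠ 0 := (ENNReal.ofReal_pos.2 hα0).ne'
  calc ENNReal.ofReal l
      = (ENNReal.ofReal α)⁻¹ * ENNReal.ofReal (l * α) := by
        rw [ENNReal.ofReal_mul' hα0.le, mul_left_comm, ENNReal.inv_mul_cancel hα'
          ENNReal.ofReal_ne_top, mul_one]
    _ ≤ (ENNReal.ofReal α)⁻¹ * ENNReal.ofReal (∫ x in (0 : ℝ)..α, g x) := by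
        gcongr
        exact h.le_integral
    _ = (μ I)⁻¹ * ∫⁻ y in I, ‖g (θ y)‖ₑ ∂μ := by
        rw [hlin, ← mul_assoc, ← mul_assoc, ENNReal.inv_mul_cancel hpos.ne' (measure_ne_top μ I),
          one_mul]
    _ ≤ maximal μ T (fun x => g (θ x)) x :=
        le_iSup_of_le I (le_iSup_of_le hI (le_iSup_of_le (hSI hx) le_rfl))

end uniform

/-- The upper bound imposed on A is the q-integral of the profile in `exists_isProfile_max`. -/
theorem Gam_mul_eq {p q f F : ℝ} (hp : 1 < p) (hf : 0 < f) (hF : 0 < F) :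
    Gam p q * f ^ ((p - q) / (p - 1)) * F ^ (p * (q - 1) / (p - 1)) =
      (F * (1 - 1 / p)) ^ q * ((f / F) ^ (1 - 1 / p)⁻¹) ^ ((1 - 1 / p - 1) * q + 1) /
        ((1 - 1 / p - 1) * q + 1) := by
  have hp0 : 0 < p := by linarith
  have hp1 : 0 < p - 1 := by linarith
  have hr : 1 - 1 / p = (p - 1) / p := by field_simp
  have he : (1 - 1 / p - 1) * q + 1 = (p - q) / p := by field_simp; ring
  have hexp : ((p - 1) / p)⁻¹ * ((p - q) / p) = (p - q) / (p - 1) := by field_simp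
  have hFexp : F ^ (p * (q - 1) / (p - 1)) = F ^ q / F ^ ((p - q) / (p - 1)) := by
    rw [← Real.rpow_sub hF]
    congr 1
    field_simp
    ring
  rw [he, hr, ← Real.rpow_mul (by positivity), hexp, Real.mul_rpow hF.le (by positivity),
    Real.div_rpow hf.le hF.le, hFexp, Gam]
  rw [div_div_eq_mul_div _ (p - q) p]
  ring

/-- The functions that approximate the supremum. -/
theorem IsTreeWith.exists_mem_classLqWeak {μ : Measure X} [IsProbabilityMeasure μ]
    {T : Set (Set X)} {C : Set X → Set (Set X)} (h : IsTreeWith μ T C) {p q f A F l β m : ℝ}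
    (hq : 1 < q) (hqp : q < p) (hf : 0 < f) (hfF : f ≤ F)
    (hA : A ≤ Gam p q * f ^ ((p - q) / (p - 1)) * F ^ (p * (q - 1) / (p - 1)))
    (hfl : f < l) (hβ0 : 0 < β) (hβm : β < m) (hm : m ≤ 1)
    (hlf : ∀ a ∈ Set.Ioo β m, l * a ≤ f)
    (hlF : ∀ a ∈ Set.Ioo β m, l * a < F * a ^ (1 - 1 / p))
    (hlA : ∀ a ∈ Set.Ioo β m, l ^ q * a + ((f - l * a) / (1 - a)) ^ q * (1 - a) < A) :
    ∃ φ ∈ classLqWeak μ p q f A F,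
      ENNReal.ofReal β ≤ μ {x | ENNReal.ofReal l ≤ maximal μ T φ x} := by
  have hp : 1 < p := hq.trans hqp
  have hF : 0 < F := hf.trans_le hfF
  have hr0 : 0 < 1 - 1 / p := sub_pos.2 ((div_lt_one (by linarith)).2 hp)
  have hr1 : 1 - 1 / p < 1 := sub_lt_self _ (by positivity)
  have hrq : -1 < (1 - 1 / p - 1) * q := by
    have h1 : q / p < 1 := (div_lt_one (by linarith)).2 hqp
    have h2 : (1 - 1 / p - 1) * q = -(q / p) := by ring
    linarith
  obtain ⟨v, hv, hv0⟩ := h.exists_measurable_null_fibers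
  -- Pieces smaller than m - β let some initial union have measure α strictly between β and m.
  obtain ⟨κ, hκ, hκ'⟩ := h.exists_partition (ENNReal.ofReal_pos.2 (sub_pos.2 hβm))
  have hsmall : ∀ j, μ.real (κ ⁻¹' {j}) < m - β := by
    intro j
    rcases Set.eq_empty_or_nonempty (κ ⁻¹' {j}) with hem | hne
    · simpa [hem] using hβm
    · obtain ⟨I, -, hI, -, hlt⟩ := hκ' j hne
      exact (ENNReal.lt_ofReal_iff_toReal_lt (measure_ne_top μ _)).1
        ((measure_mono hI).trans_lt hlt)
  obtain ⟨n, hn1, hn2⟩ := exists_measure_preimage_Iio_mem hβm hm hsmall hβ0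
  set α := μ.real (κ ⁻¹' Set.Iio n) with hα
  have hmem : α ∈ Set.Ioo β m := ⟨hn1, hn2⟩
  have hα0 : 0 < α := hβ0.trans hn1
  have hα1 : α < 1 := hn2.trans_le hm
  have hμα : μ (κ ⁻¹' Set.Iio n) = ENNReal.ofReal α := (ofReal_measureReal).symm
  obtain ⟨θ, hθ, hθ0, hmap, hmapj⟩ := exists_uniform_of_partition hv hv0 hκ n hα0 hα1 hμα
  obtain ⟨g₀, hg₀, hA₀⟩ := exists_isProfile_lt hf hfF hr0 hr1 hrq hα0 hα1 hfl (hlf α hmem)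
    (hlF α hmem) (hlA α hmem)
  obtain ⟨g₁, hg₁, hA₁⟩ := exists_isProfile_max hf hfF hr0 hr1 (by linarith : q ≠ 0) hrq hα0
    (hlf α hmem) (hlF α hmem).le
  rw [← Gam_mul_eq hp hf hF] at hA₁
  obtain ⟨g, hg, hgA⟩ := hg₀.exists_integral_rpow_eq hg₁ hr0 hα0.le hα1.le (by linarith) hrq
    hA₀.le (hA₁ ▸ hA)
  refine ⟨_, hg.comp_mem_classLqWeak hr0 (by linarith) hrq hgA hθ hθ0 hmap, ?_⟩
  refine (ENNReal.ofReal_le_ofReal hn1.le).trans (hμα ▸ measure_mono fun x hx => ?_)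
  obtain ⟨I, hI, hsub, hae, -⟩ := hκ' (κ x) ⟨x, rfl⟩
  exact hg.le_maximal_comp hr0 hα0 hα1.le hθ hI hsub hae (h.measure_pos I hI)
    (hmapj (κ x) hx) rfl

/-! ### Convexity and the upper bounds -/

/-- Bernoulli's inequality at y/c, scaled by c^q. -/
theorem rpow_tangent_le {q c y : ℝ} (hq : 1 < q) (hc : 0 ≤ c) (hy : 0 ≤ y) :
    c ^ q + q * c ^ (q - 1) * (y - c) ≤ y ^ q := by
  rcases hc.eq_or_lt with rfl | hc
  · rw [Real.zero_rpow (by linarith), Real.zero_rpow (by linarith)]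
    simpa using Real.rpow_nonneg hy q
  · have hs : -1 ≤ y / c - 1 := by linarith [div_nonneg hy hc.le]
    have h := one_add_mul_self_le_rpow_one_add hs hq.le
    rw [add_sub_cancel, Real.div_rpow hy hc.le, le_div_iff₀ (by positivity)] at h
    have h2 : c ^ q = c ^ (q - 1) * c := by
      rw [← Real.rpow_add_one hc.ne', sub_add_cancel]
    calc c ^ q + q * c ^ (q - 1) * (y - c) = (1 + q * (y / c - 1)) * c ^ q := by
          rw [h2]
          field_simp
      _ ≤ y ^ q := h

/-- The smallest `q`-th power integral of a nonnegative function with integral `f` and average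
`l` over a set of measure `a`. -/
noncomputable def minPower (q f l a : ℝ) : ℝ :=
  l ^ q * a + ((f - l * a) / (1 - a)) ^ q * (1 - a)

theorem minPower_eq {q f l a : ℝ} (ha : a < 1) (hal : a * l ≤ f) :
    (f - a * l) ^ q / (1 - a) ^ (q - 1) + a * l ^ q = minPower q f l a := by
  have h1 : 0 < 1 - a := by linarith
  rw [minPower, mul_comm l a, Real.div_rpow (by linarith) h1.le, Real.rpow_sub_one h1.ne']
  field_simp
  ring

/-- Passing from a to b > a splits the constant value on the complement into l, on mass b - a, and a
smaller c on mass 1 - b, with the same mean. Strict convexity makes the power integral grow. -/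
theorem minPower_strictMonoOn {q f l : ℝ} (hq : 1 < q) (hf : 0 < f) (hfl : f < l) :
    StrictMonoOn (minPower q f l) (Set.Icc 0 (f / l)) := by
  intro a ha b hb hab
  have hl : 0 < l := hf.trans hfl
  have hb1 : b < 1 := hb.2.trans_lt ((div_lt_one hl).2 hfl)
  have hbl : l * b ≤ f := by rw [mul_comm]; exact (le_div_iff₀ hl).1 hb.2
  have h1b : 0 < 1 - b := by linarith
  have h1a : 0 < 1 - a := by linarith
  set c := (f - l * b) / (1 - b) with hc
  have hc0 : 0 ≤ c := div_nonneg (by linarith) h1b.le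
  have hcl : c < l := by
    rw [hc, div_lt_iff₀ h1b]
    linarith
  have hcb : c * (1 - b) = f - l * b := by rw [hc]; field_simp
  have hstrict := (strictConvexOn_rpow hq).2 (show l ∈ Set.Ici (0 : ℝ) from hl.le)
    (show c ∈ Set.Ici (0 : ℝ) from hc0) hcl.ne'
    (show 0 < (b - a) / (1 - a) from div_pos (by linarith) h1a)
    (show 0 < (1 - b) / (1 - a) from div_pos h1b h1a) (by field_simp; ring)
  simp only [smul_eq_mul] at hstrict
  have hcomb : (b - a) / (1 - a) * l + (1 - b) / (1 - a) * c = (f - l * a) / (1 - a) := by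
    rw [div_mul_eq_mul_div, div_mul_eq_mul_div, ← add_div]
    congr 1
    linear_combination hcb
  rw [hcomb] at hstrict
  have h2 : ((f - l * a) / (1 - a)) ^ q * (1 - a) < (b - a) * l ^ q + (1 - b) * c ^ q := by
    calc _ < ((b - a) / (1 - a) * l ^ q + (1 - b) / (1 - a) * c ^ q) * (1 - a) :=
          mul_lt_mul_of_pos_right hstrict h1a
      _ = _ := by field_simp
  simp only [minPower, ← hc]
  linarith

theorem continuousOn_minPower {q f l : ℝ} (hq : 1 < q) (hf : 0 < f) (hfl : f < l) :
    ContinuousOn (minPower q f l) (Set.Icc 0 (f / l)) := by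
  have hl : 0 < l := hf.trans hfl
  have h1 : ∀ a ∈ Set.Icc 0 (f / l), 1 - a ≠ 0 := fun a ha =>
    (sub_pos.2 (ha.2.trans_lt ((div_lt_one hl).2 hfl))).ne'
  have h2 : ContinuousOn (fun a => (f - l * a) / (1 - a)) (Set.Icc 0 (f / l)) :=
    ContinuousOn.div (by fun_prop) (by fun_prop) h1
  exact (by fun_prop : ContinuousOn (fun a => l ^ q * a) _).add
    ((h2.rpow_const fun _ _ => Or.inr (by linarith)).mul (by fun_prop))

theorem minPower_zero (q f l : ℝ) : minPower q f l 0 = f ^ q := by simp [minPower]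

theorem minPower_div {q f l : ℝ} (hq : 1 < q) (hl : 0 < l) :
    minPower q f l (f / l) = f * l ^ (q - 1) := by
  rw [minPower, mul_div_cancel₀ _ hl.ne', sub_self, zero_div, Real.zero_rpow (by linarith),
    Real.rpow_sub_one hl.ne']
  field_simp
  simp

section upper

variable {μ : Measure X} [IsProbabilityMeasure μ] {T : Set (Set X)} {C : Set X → Set (Set X)}
  {p q f A F l : ℝ} {φ : X → ℝ}

theorem IsTreeWith.mul_measureReal_le (h : IsTreeWith μ T C) (hφ : φ ∈ classLq μ q f A)
    (hl : 0 < l) :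
    l * μ.real {x | ENNReal.ofReal l ≤ maximal μ T φ x} ≤
      ∫ x in {x | ENNReal.ofReal l ≤ maximal μ T φ x}, φ x ∂μ := by
  have h1 := h.mul_measure_le_maximal_le hφ.2.1 hl
  rw [lintegral_enorm_eq_ofReal hφ.1 hφ.2.1, ← ofReal_measureReal, ← ENNReal.ofReal_mul hl.le,
    ENNReal.ofReal_le_ofReal_iff (setIntegral_nonneg_of_ae (Eventually.of_forall hφ.1))] at h1
  exact h1

theorem IsTreeWith.measureReal_mem_Icc (h : IsTreeWith μ T C) (hφ : φ ∈ classLq μ q f A)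
    (hl : 0 < l) :
    μ.real {x | ENNReal.ofReal l ≤ maximal μ T φ x} ∈ Set.Icc 0 (f / l) := by
  refine ⟨measureReal_nonneg, ?_⟩
  rw [le_div_iff₀ hl, mul_comm, ← hφ.2.2.1]
  exact (h.mul_measureReal_le hφ hl).trans
    (setIntegral_le_integral hφ.2.1 (Eventually.of_forall hφ.1))

/-- Tangent lines to y^q are used at l on E and at c on the complement. The first-order terms add up
to q (l^(q-1) - c^(q-1)) (∫_E φ - lα), which is nonnegative because c ≤ l. -/
theorem minPower_le_of_mul_measureReal_le (hq : 1 < q) (hf : 0 < f) (hfl : f < l)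
    (hφ : φ ∈ classLq μ q f A) {E : Set X} (hE : MeasurableSet E)
    (hl : l * μ.real E ≤ ∫ x in E, φ x ∂μ) : minPower q f l (μ.real E) ≤ A := by
  obtain ⟨h0, hint, hf', hintq, hA⟩ := hφ
  set α := μ.real E with hα
  have hl0 : 0 < l := hf.trans hfl
  have hEf : ∫ x in E, φ x ∂μ ≤ f :=
    hf' ▸ setIntegral_le_integral hint (Eventually.of_forall h0)
  have hα0 : 0 ≤ α := measureReal_nonneg
  have hα1 : α < 1 := by
    have h1 : l * α < l * 1 := by linarith
    exact lt_of_mul_lt_mul_left h1 hl0.le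
  have h1α : 0 < 1 - α := by linarith
  set c := (f - l * α) / (1 - α) with hc
  have hc0 : 0 ≤ c := div_nonneg (by linarith) h1α.le
  have hcl : c ≤ l := by
    rw [hc, div_le_iff₀ h1α]
    linarith
  have hcα : c * (1 - α) = f - l * α := by rw [hc]; field_simp
  have tangent : ∀ (S : Set X) (d : ℝ), 0 ≤ d →
      d ^ q * μ.real S + q * d ^ (q - 1) * ((∫ x in S, φ x ∂μ) - d * μ.real S) ≤
        ∫ x in S, φ x ^ q ∂μ := by
    intro S d hd
    have hsub : IntegrableOn (fun x => φ x - d) S μ :=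
      (hint.sub (integrable_const d)).integrableOn
    have h1 : ∫ x in S, (d ^ q + q * d ^ (q - 1) * (φ x - d)) ∂μ ≤ ∫ x in S, φ x ^ q ∂μ :=
      integral_mono ((integrable_const _).add (hsub.const_mul _)) hintq.integrableOn
        fun x => rpow_tangent_le hq hd (h0 x)
    rw [integral_add (integrable_const _) (hsub.const_mul _), integral_const_mul,
      integral_sub hint.integrableOn (integrable_const _), setIntegral_const,
      setIntegral_const, smul_eq_mul, smul_eq_mul] at h1
    linarith
  have t1 := tangent E l hl0.le
  have t2 := tangent Eᶜ c hc0
  have s1 := integral_add_compl hE hint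
  have s2 := integral_add_compl hE hintq
  have s3 : μ.real Eᶜ = 1 - α := probReal_compl_eq_one_sub hE
  rw [s3] at t2
  rw [← hα] at t1
  have hmono : c ^ (q - 1) ≤ l ^ (q - 1) := Real.rpow_le_rpow hc0 hcl (by linarith)
  have hprod : 0 ≤ q * (l ^ (q - 1) - c ^ (q - 1)) * ((∫ x in E, φ x ∂μ) - l * α) :=
    mul_nonneg (mul_nonneg (by linarith) (by linarith)) (by linarith)
  have hcompl : (∫ x in Eᶜ, φ x ∂μ) - c * (1 - α) = -((∫ x in E, φ x ∂μ) - l * α) := by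
    linarith
  rw [hcompl] at t2
  rw [minPower, ← hc]
  linarith

theorem IsTreeWith.extremalG_le (h : IsTreeWith μ T C) (hq : 1 < q) (hf : 0 < f) (hfl : f < l)
    {k : ℝ} (hk : ∀ a ∈ Set.Icc 0 (f / l), minPower q f l a ≤ A → a ≤ k) :
    extremalG μ T q f A l ≤ ENNReal.ofReal k := by
  have hl : 0 < l := hf.trans hfl
  refine iSup₂_le fun φ hφ => ?_
  rw [← ofReal_measureReal]
  refine ENNReal.ofReal_le_ofReal (hk _ (h.measureReal_mem_Icc hφ hl) ?_)
  exact minPower_le_of_mul_measureReal_le hq hf hfl hφ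
    (measurableSet_le measurable_const (h.measurable_maximal φ)) (h.mul_measureReal_le hφ hl)

theorem IsTreeWith.measure_le_div_rpow (h : IsTreeWith μ T C) (hp : 1 < p) (hF : 0 < F)
    (hl : 0 < l) (hφ : φ ∈ classLqWeak μ p q f A F) :
    μ {x | ENNReal.ofReal l ≤ maximal μ T φ x} ≤ ENNReal.ofReal (F ^ p / l ^ p) := by
  set E := {x | ENNReal.ofReal l ≤ maximal μ T φ x} with hEdef
  have hE : MeasurableSet E := measurableSet_le measurable_const (h.measurable_maximal φ)
  rcases eq_or_ne (μ E) 0 with h0 | h0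
  · rw [h0]
    exact zero_le
  have hpos : 0 < μ E := pos_iff_ne_zero.2 h0
  have hα : 0 < μ.real E := ENNReal.toReal_pos h0 (measure_ne_top μ E)
  have h1 := (h.mul_measureReal_le hφ.1 hl).trans
    (setIntegral_le_of_weakNorm_le hφ.1.1 hφ.1.2.1 hF.le hφ.2.le hE hpos)
  rw [← hEdef] at h1
  rw [← ofReal_measureReal]
  refine ENNReal.ofReal_le_ofReal ?_
  have hp0 : 0 < p := by linarith
  have h2 : μ.real E = μ.real E ^ (1 / p) * μ.real E ^ (1 - 1 / p) := by
    rw [← Real.rpow_add hα, add_sub_cancel, Real.rpow_one]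
  have h3 : l * μ.real E ^ (1 / p) ≤ F := by
    refine le_of_mul_le_mul_right ?_ (Real.rpow_pos_of_pos hα (1 - 1 / p))
    rw [mul_assoc, ← h2]
    exact h1
  rw [le_div_iff₀ (by positivity)]
  calc μ.real E * l ^ p = (l * μ.real E ^ (1 / p)) ^ p := by
        rw [Real.mul_rpow hl.le (by positivity), ← Real.rpow_mul hα.le, one_div_mul_cancel hp0.ne',
          Real.rpow_one, mul_comm]
    _ ≤ F ^ p := Real.rpow_le_rpow (by positivity) h3 hp0.le

theorem ofReal_integral_le_maximal (hT : Set.univ ∈ T) (hφ : φ ∈ classLq μ q f A) (x : X) :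
    ENNReal.ofReal f ≤ maximal μ T φ x := by
  refine le_iSup_of_le Set.univ (le_iSup_of_le hT (le_iSup_of_le trivial ?_))
  rw [lintegral_enorm_eq_ofReal hφ.1 hφ.2.1, setIntegral_univ, hφ.2.2.1, measure_univ, inv_one,
    one_mul]

end upper

/-! ### Lower bounds for the suprema -/

section lower

variable {μ : Measure X} [IsProbabilityMeasure μ] {T : Set (Set X)} {C : Set X → Set (Set X)}
  {p q f A F l : ℝ}

theorem mul_lt_mul_rpow_of_lt_div {a : ℝ} (hp : 1 < p) (hF : 0 < F) (hl : 0 < l) (ha : 0 < a)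
    (h : a < F ^ p / l ^ p) : l * a < F * a ^ (1 - 1 / p) := by
  have hp0 : 0 < p := by linarith
  have h1 : a ^ (1 / p) < F / l := by
    rw [one_div, Real.rpow_inv_lt_iff_of_pos ha.le (by positivity) hp0, Real.div_rpow hF.le hl.le]
    exact h
  have h2 : a = a ^ (1 / p) * a ^ (1 - 1 / p) := by
    rw [← Real.rpow_add ha, add_sub_cancel, Real.rpow_one]
  have h3 : 0 < a ^ (1 - 1 / p) := by positivity
  calc l * a = l * a ^ (1 / p) * a ^ (1 - 1 / p) := by rw [mul_assoc, ← h2]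
    _ < F * a ^ (1 - 1 / p) := by
      refine mul_lt_mul_of_pos_right ?_ h3
      rw [mul_comm]
      exact (lt_div_iff₀ hl).1 h1

theorem IsTreeWith.exists_mem_classLqWeak_of_minPower_lt (h : IsTreeWith μ T C)
    (hq : 1 < q) (hqp : q < p) (hf : 0 < f) (hfF : f ≤ F)
    (hA : A ≤ Gam p q * f ^ ((p - q) / (p - 1)) * F ^ (p * (q - 1) / (p - 1)))
    (hfl : f < l) {β m : ℝ} (hβ0 : 0 < β) (hβm : β < m) (hmf : m ≤ f / l)
    (hmF : m ≤ F ^ p / l ^ p) (hm : ∀ a ∈ Set.Ioo 0 m, minPower q f l a < A) :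
    ∃ φ ∈ classLqWeak μ p q f A F,
      ENNReal.ofReal β ≤ μ {x | ENNReal.ofReal l ≤ maximal μ T φ x} := by
  have hl : 0 < l := hf.trans hfl
  have hpos : ∀ a ∈ Set.Ioo β m, 0 < a := fun a ha => hβ0.trans ha.1
  refine h.exists_mem_classLqWeak hq hqp hf hfF hA hfl hβ0 hβm
    (hmf.trans ((div_le_one hl).2 hfl.le)) (fun a ha => ?_) (fun a ha => ?_) fun a ha =>
      hm a ⟨hpos a ha, ha.2⟩
  · rw [mul_comm]
    exact (le_div_iff₀ hl).1 (ha.2.le.trans hmf)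
  · exact mul_lt_mul_rpow_of_lt_div (hq.trans hqp) (hf.trans_le hfF) hl (hpos a ha)
      (ha.2.trans_le hmF)

theorem IsTreeWith.ofReal_le_iSup_classLqWeak (h : IsTreeWith μ T C)
    (hq : 1 < q) (hqp : q < p) (hf : 0 < f) (hfF : f ≤ F)
    (hA : A ≤ Gam p q * f ^ ((p - q) / (p - 1)) * F ^ (p * (q - 1) / (p - 1)))
    (hfl : f < l) {m : ℝ} (hm0 : 0 < m) (hmf : m ≤ f / l)
    (hmF : m ≤ F ^ p / l ^ p) (hm : ∀ a ∈ Set.Ioo 0 m, minPower q f l a < A) :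
    ENNReal.ofReal m ≤ ⨆ φ ∈ classLqWeak μ p q f A F,
      μ {x | ENNReal.ofReal l ≤ maximal μ T φ x} := by
  -- The construction reaches every β < m; the supremum then reaches m.
  have hlim : Tendsto (fun t => ENNReal.ofReal t) (𝓝[<] m) (𝓝 (ENNReal.ofReal m)) :=
    (ENNReal.continuous_ofReal.tendsto m).mono_left nhdsWithin_le_nhds
  refine le_of_tendsto hlim ?_
  filter_upwards [Ioo_mem_nhdsLT hm0] with β hβ
  obtain ⟨φ, hφ, hle⟩ := h.exists_mem_classLqWeak_of_minPower_lt hq hqp hf hfF hA hfl hβ.1 hβ.2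
    hmf hmF hm
  exact hle.trans (le_iSup₂_of_le φ hφ le_rfl)

/-- The class without a weak norm contains the weak classes for every exponent and every F. With
exponent q + 1 and F large, the constraints involving F become harmless. -/
theorem IsTreeWith.ofReal_le_extremalG (h : IsTreeWith μ T C) (hq : 1 < q) (hf : 0 < f)
    (hfl : f < l) {m : ℝ} (hm0 : 0 < m) (hmf : m ≤ f / l)
    (hm : ∀ a ∈ Set.Ioo 0 m, minPower q f l a < A) :
    ENNReal.ofReal m ≤ extremalG μ T q f A l := by
  have hl : 0 < l := hf.trans hfl
  have hGam : 0 < Gam (q + 1) q * f ^ ((q + 1 - q) / (q + 1 - 1)) := by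
    rw [Gam]
    have : 0 < q := by linarith
    have h1 : 0 < q + 1 - 1 := by linarith
    have h2 : 0 < q + 1 - q := by linarith
    positivity
  have e1 : ∀ᶠ F : ℝ in atTop, A ≤ Gam (q + 1) q * f ^ ((q + 1 - q) / (q + 1 - 1)) *
      F ^ ((q + 1) * (q - 1) / (q + 1 - 1)) :=
    ((tendsto_rpow_atTop (div_pos (mul_pos (by linarith) (by linarith))
      (by linarith))).const_mul_atTop hGam).eventually_ge_atTop A
  have e2 : ∀ᶠ F : ℝ in atTop, m ≤ F ^ (q + 1) / l ^ (q + 1) :=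
    ((tendsto_rpow_atTop (by linarith : 0 < q + 1)).atTop_div_const
      (by positivity)).eventually_ge_atTop m
  obtain ⟨F, h1, h2, h3⟩ := (e1.and (e2.and (eventually_ge_atTop f))).exists
  refine (h.ofReal_le_iSup_classLqWeak hq (by linarith) hf h3 h1 hfl hm0 hmf h2 hm).trans ?_
  exact iSup₂_le fun φ hφ => le_iSup₂_of_le φ hφ.1 le_rfl

end lower

/-! ### Thresholds and the values of the suprema -/

/-- By `minPower_div`, the right side says that `minPower` is still below A at the endpoint f/l, so
this value of l separates the two regimes of G. -/
theorem lt_rpow_one_div_sub_one_iff {q f A l : ℝ} (hq : 1 < q) (hf : 0 < f) (hA : 0 < A)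
    (hl : 0 < l) : l < (A / f) ^ (1 / (q - 1)) ↔ f * l ^ (q - 1) < A := by
  rw [one_div, Real.lt_rpow_inv_iff_of_pos hl.le (by positivity) (by linarith), lt_div_iff₀ hf,
    mul_comm]

theorem lt_of_rpow_one_div_sub_one_le {q f A l : ℝ} (hq : 1 < q) (hf : 0 < f) (hA : f ^ q < A)
    (h : (A / f) ^ (1 / (q - 1)) ≤ l) : f < l := by
  refine lt_of_lt_of_le ?_ h
  rw [lt_rpow_one_div_sub_one_iff hq hf ((Real.rpow_pos_of_pos hf q).trans hA) hf, mul_comm,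
    ← Real.rpow_add_one hf.ne', sub_add_cancel]
  exact hA

theorem exists_minPower_eq {q f A l : ℝ} (hq : 1 < q) (hf : 0 < f) (hfl : f < l)
    (hA : f ^ q < A) (hAl : A ≤ f * l ^ (q - 1)) :
    ∃ k ∈ Set.Ioc 0 (f / l), minPower q f l k = A := by
  have hl : 0 < l := hf.trans hfl
  obtain ⟨k, hk, hkA⟩ := intermediate_value_Icc (by positivity : 0 ≤ f / l)
    (continuousOn_minPower hq hf hfl)
    (show A ∈ Set.Icc _ _ from ⟨by rw [minPower_zero]; exact hA.le, by rwa [minPower_div hq hl]⟩)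
  refine ⟨k, ⟨hk.1.lt_of_ne ?_, hk.2⟩, hkA⟩
  rintro rfl
  rw [minPower_zero] at hkA
  exact hA.ne hkA

/-- The threshold of the measure of the level set. -/
theorem exists_threshold {q f A l : ℝ} (hq : 1 < q) (hf : 0 < f) (hfl : f < l)
    (hA : f ^ q < A) :
    ∃ k ∈ Set.Ioc 0 (f / l), (∀ a ∈ Set.Ioo 0 k, minPower q f l a < A) ∧
      ∀ a ∈ Set.Icc 0 (f / l), minPower q f l a ≤ A → a ≤ k := by
  have hl : 0 < l := hf.trans hfl
  have hmono := minPower_strictMonoOn hq hf hfl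
  rcases lt_or_ge (f * l ^ (q - 1)) A with h | h
  · have hpos : 0 < f / l := by positivity
    refine ⟨f / l, ⟨hpos, le_rfl⟩, fun a ha => ?_, fun a ha _ => ha.2⟩
    rw [← minPower_div hq hl] at h
    exact (hmono ⟨ha.1.le, ha.2.le⟩ ⟨hpos.le, le_rfl⟩ ha.2).trans h
  · obtain ⟨k, hk, hkA⟩ := exists_minPower_eq hq hf hfl hA h
    have hk' : k ∈ Set.Icc 0 (f / l) := ⟨hk.1.le, hk.2⟩
    refine ⟨k, hk, fun a ha => ?_, fun a ha haA => ?_⟩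
    · exact hkA ▸ hmono ⟨ha.1.le, ha.2.le.trans hk.2⟩ hk' ha.2
    · rw [← hkA] at haA
      exact (hmono.le_iff_le ha hk').1 haA

/-- As q < p, a set of measure F^p / l^p at height l costs no q-power and no mass in the limit. As
f^q < A, only the weak norm restricts large l. -/
theorem tendsto_minPower_div_rpow {p q f F : ℝ} (hq : 1 < q) (hqp : q < p) :
    Tendsto (fun l : ℝ => minPower q f l (F ^ p / l ^ p)) atTop (𝓝 (f ^ q)) ∧
      Tendsto (fun l : ℝ => l * (F ^ p / l ^ p)) atTop (𝓝 0) := by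
  have key : ∀ k : ℝ, k < p → Tendsto (fun l : ℝ => l ^ k * (F ^ p / l ^ p)) atTop (𝓝 0) := by
    intro k hk
    have h1 := (tendsto_rpow_neg_atTop (sub_pos.2 hk)).const_mul (F ^ p)
    rw [mul_zero] at h1
    refine h1.congr' ?_
    filter_upwards [eventually_gt_atTop 0] with l hl
    rw [neg_sub, Real.rpow_sub hl]
    ring
  have k0 : Tendsto (fun l : ℝ => F ^ p / l ^ p) atTop (𝓝 0) := by
    simpa using key 0 (by linarith)
  have k1 : Tendsto (fun l : ℝ => l * (F ^ p / l ^ p)) atTop (𝓝 0) := by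
    simpa using key 1 (by linarith)
  refine ⟨?_, k1⟩
  have hd : Tendsto (fun l : ℝ => 1 - F ^ p / l ^ p) atTop (𝓝 (1 - 0)) := k0.const_sub 1
  have hn : Tendsto (fun l : ℝ => f - l * (F ^ p / l ^ p)) atTop (𝓝 (f - 0)) := k1.const_sub f
  have := (key q hqp).add (((hn.div hd (by simp)).rpow_const (Or.inr (by linarith : 0 ≤ q))).mul hd)
  simpa [minPower] using this

theorem IsTreeWith.extremalG_eq_one {μ : Measure X} [IsProbabilityMeasure μ] {T : Set (Set X)}
    {C : Set X → Set (Set X)} (h : IsTreeWith μ T C) {q f A l : ℝ} (hlf : l ≤ f)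
    (hne : (classLq μ q f A).Nonempty) : extremalG μ T q f A l = 1 := by
  obtain ⟨φ, hφ⟩ := hne
  refine le_antisymm (iSup₂_le fun _ _ => prob_le_one) (le_iSup₂_of_le φ hφ ?_)
  have : {x | ENNReal.ofReal l ≤ maximal μ T φ x} = Set.univ :=
    Set.eq_univ_of_forall fun x => (ENNReal.ofReal_le_ofReal hlf).trans
      (ofReal_integral_le_maximal h.univ_mem hφ x)
  rw [this, measure_univ]

/-- The construction is run at an arbitrary level above f; f + 1 is one choice. -/
theorem IsTreeWith.classLqWeak_nonempty {μ : Measure X} [IsProbabilityMeasure μ]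
    {T : Set (Set X)} {C : Set X → Set (Set X)} (h : IsTreeWith μ T C) {p q f A F : ℝ}
    (hq : 1 < q) (hqp : q < p) (hf : 0 < f) (hfF : f ≤ F) (hA : f ^ q < A)
    (hA' : A ≤ Gam p q * f ^ ((p - q) / (p - 1)) * F ^ (p * (q - 1) / (p - 1))) :
    (classLqWeak μ p q f A F).Nonempty := by
  have hfl : f < f + 1 := by linarith
  obtain ⟨k, hk, hlt, -⟩ := exists_threshold hq hf hfl hA
  have hF : 0 < F := hf.trans_le hfF
  have hl : 0 < f + 1 := by linarith
  have hm : 0 < min k (F ^ p / (f + 1) ^ p) := lt_min hk.1 (by positivity)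
  obtain ⟨φ, hφ, -⟩ := h.exists_mem_classLqWeak_of_minPower_lt hq hqp hf hfF hA' hfl
    (half_pos hm) (half_lt_self hm) ((min_le_left _ _).trans hk.2) (min_le_right _ _)
    fun a ha => hlt a ⟨ha.1, ha.2.trans_le (min_le_left _ _)⟩
  exact ⟨φ, hφ⟩

theorem IsTreeWith.iSup_measure_classLqWeak {μ : Measure X} [IsProbabilityMeasure μ]
    {T : Set (Set X)} {C : Set X → Set (Set X)} (h : IsTreeWith μ T C) {p q f A F l : ℝ}
    (hq : 1 < q) (hqp : q < p) (hf : 0 < f) (hfF : f ≤ F) (hA : f ^ q < A)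
    (hA' : A ≤ Gam p q * f ^ ((p - q) / (p - 1)) * F ^ (p * (q - 1) / (p - 1))) (hl : 0 < l) :
    (⨆ φ ∈ classLqWeak μ p q f A F, μ {x | ENNReal.ofReal l ≤ maximal μ T φ x}) =
      min 1 (min (extremalG μ T q f A l) (ENNReal.ofReal (F ^ p / l ^ p))) := by
  have hF : 0 < F := hf.trans_le hfF
  refine le_antisymm (iSup₂_le fun φ hφ => le_min prob_le_one (le_min ?_ ?_)) ?_
  · exact le_iSup₂_of_le φ hφ.1 le_rfl
  · exact h.measure_le_div_rpow (hq.trans hqp) hF hl hφ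
  rcases le_or_gt l f with hlf | hfl
  · obtain ⟨φ, hφ⟩ := h.classLqWeak_nonempty hq hqp hf hfF hA hA'
    refine (min_le_left _ _).trans (le_iSup₂_of_le φ hφ ?_)
    have : {x | ENNReal.ofReal l ≤ maximal μ T φ x} = Set.univ :=
      Set.eq_univ_of_forall fun x => (ENNReal.ofReal_le_ofReal hlf).trans
        (ofReal_integral_le_maximal h.univ_mem hφ.1 x)
    rw [this, measure_univ]
  · obtain ⟨k, hk, hlt, hge⟩ := exists_threshold hq hf hfl hA
    have hm : 0 < min k (F ^ p / l ^ p) := lt_min hk.1 (by positivity)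
    -- Only G ≤ k is needed: the construction already reaches min(k, F^p / l^p).
    refine (min_le_right _ _).trans ((min_le_min_right _ (h.extremalG_le hq hf hfl hge)).trans ?_)
    rw [← ENNReal.ofReal_min]
    exact h.ofReal_le_iSup_classLqWeak hq hqp hf hfF hA' hfl hm
      ((min_le_left _ _).trans hk.2) (min_le_right _ _)
      fun a ha => hlt a ⟨ha.1, ha.2.trans_le (min_le_left _ _)⟩

theorem IsTreeWith.iSup_weakQuasiNorm_classLqWeak {μ : Measure X} [IsProbabilityMeasure μ]
    {T : Set (Set X)} {C : Set X → Set (Set X)} (h : IsTreeWith μ T C) {p q f A F : ℝ}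
    (hq : 1 < q) (hqp : q < p) (hf : 0 < f) (hfF : f ≤ F) (hA : f ^ q < A)
    (hA' : A ≤ Gam p q * f ^ ((p - q) / (p - 1)) * F ^ (p * (q - 1) / (p - 1))) :
    (⨆ φ ∈ classLqWeak μ p q f A F, weakQuasiNorm μ p (maximal μ T φ)) = ENNReal.ofReal F := by
  have hF : 0 < F := hf.trans_le hfF
  have hp : 1 < p := hq.trans hqp
  have hp0 : 0 < p := by linarith
  have hroot : ∀ t : ℝ, 0 < t → t * (F ^ p / t ^ p) ^ (1 / p) = F := by
    intro t ht
    rw [← Real.div_rpow hF.le ht.le, ← Real.rpow_mul (by positivity), mul_one_div_cancel hp0.ne',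
      Real.rpow_one]
    field_simp
  refine le_antisymm (iSup₂_le fun φ hφ => iSup₂_le fun t ht => ?_) ?_
  · calc ENNReal.ofReal t * μ {x | ENNReal.ofReal t ≤ maximal μ T φ x} ^ (1 / p)
        ≤ ENNReal.ofReal t * ENNReal.ofReal (F ^ p / t ^ p) ^ (1 / p) := by
          gcongr
          exact h.measure_le_div_rpow hp hF ht hφ
      _ = ENNReal.ofReal F := by
          rw [ENNReal.ofReal_rpow_of_pos (by positivity), ← ENNReal.ofReal_mul ht.le, hroot t ht]
  · obtain ⟨hlim, hlim1⟩ := tendsto_minPower_div_rpow (f := f) (F := F) hq hqp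
    -- A single large l suffices: there F^p / l^p lies below f/l and satisfies the q-power
    -- constraint strictly, and l (F^p / l^p)^(1/p) = F.
    obtain ⟨l, h1, h2, hfl⟩ := ((hlim.eventually (gt_mem_nhds hA)).and
      ((hlim1.eventually (gt_mem_nhds hf)).and (eventually_gt_atTop f))).exists
    have hl : 0 < l := hf.trans hfl
    set m := F ^ p / l ^ p with hm
    have hm0 : 0 < m := by positivity
    have hmf : m ≤ f / l := by
      rw [le_div_iff₀ hl, mul_comm]
      exact h2.le
    have hlimβ : Tendsto (fun β : ℝ => ENNReal.ofReal (l * β ^ (1 / p))) (𝓝[<] m)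
        (𝓝 (ENNReal.ofReal (l * m ^ (1 / p)))) := by
      refine ((ENNReal.continuous_ofReal.tendsto _).comp ?_).mono_left nhdsWithin_le_nhds
      exact (tendsto_id.rpow_const (Or.inl hm0.ne')).const_mul l
    rw [hroot l hl] at hlimβ
    refine le_of_tendsto hlimβ ?_
    filter_upwards [Ioo_mem_nhdsLT hm0] with β hβ
    obtain ⟨φ, hφ, hle⟩ := h.exists_mem_classLqWeak_of_minPower_lt hq hqp hf hfF hA' hfl hβ.1 hβ.2
      hmf le_rfl fun a ha => (minPower_strictMonoOn hq hf hfl ⟨ha.1.le, ha.2.le.trans hmf⟩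
        ⟨hm0.le, hmf⟩ ha.2).trans h1
    refine le_iSup₂_of_le φ hφ (le_iSup₂_of_le l hl ?_)
    rw [ENNReal.ofReal_mul hl.le, ← ENNReal.ofReal_rpow_of_pos hβ.1]
    gcongr

theorem IsTreeWith.extremalG_eq_of_lt {μ : Measure X} [IsProbabilityMeasure μ]
    {T : Set (Set X)} {C : Set X → Set (Set X)} (h : IsTreeWith μ T C) {q f A l : ℝ}
    (hq : 1 < q) (hf : 0 < f) (hfl : f < l) (hA : f * l ^ (q - 1) < A) :
    extremalG μ T q f A l = ENNReal.ofReal (f / l) := by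
  have hl : 0 < l := hf.trans hfl
  have hpos : 0 < f / l := by positivity
  refine le_antisymm (h.extremalG_le hq hf hfl fun a ha _ => ha.2)
    (h.ofReal_le_extremalG hq hf hfl hpos le_rfl fun a ha => ?_)
  rw [← minPower_div hq hl] at hA
  exact (minPower_strictMonoOn hq hf hfl ⟨ha.1.le, ha.2.le⟩ ⟨hpos.le, le_rfl⟩ ha.2).trans hA

theorem IsTreeWith.extremalG_eq_of_minPower_eq {μ : Measure X} [IsProbabilityMeasure μ]
    {T : Set (Set X)} {C : Set X → Set (Set X)} (h : IsTreeWith μ T C) {q f A l k : ℝ}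
    (hq : 1 < q) (hf : 0 < f) (hfl : f < l) (hk : k ∈ Set.Ioc 0 (f / l))
    (hkA : minPower q f l k = A) : extremalG μ T q f A l = ENNReal.ofReal k := by
  have hmono := minPower_strictMonoOn hq hf hfl
  have hk' : k ∈ Set.Icc 0 (f / l) := ⟨hk.1.le, hk.2⟩
  refine le_antisymm (h.extremalG_le hq hf hfl fun a ha haA => ?_)
    (h.ofReal_le_extremalG hq hf hfl hk.1 hk.2 fun a ha => ?_)
  · rw [← hkA] at haA
    exact (hmono.le_iff_le ha hk').1 haA
  · exact hkA ▸ hmono ⟨ha.1.le, ha.2.le.trans hk.2⟩ hk' ha.2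

end TreeMaximal

open TreeMaximal in
theorem theorem4p2 {X : Type*} [MeasurableSpace X] (μ : Measure X) [IsProbabilityMeasure μ]
    (hμ : TreeMaximal.IsNonatomic μ) (T : Set (Set X)) (hT : TreeMaximal.IsTree μ T)
    (p q f A F : ℝ) (hq : 1 < q) (hqp : q < p) (hf : 0 < f) (hfF : f ≤ F)
    (hA : f ^ q < A)
    (hA' : A ≤ TreeMaximal.Gam p q * f ^ ((p - q) / (p - 1)) * F ^ (p * (q - 1) / (p - 1))) :
    -- the extremal function with the weak norm prescribed
    (∀ l : ℝ, 0 < l →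
      (⨆ φ ∈ TreeMaximal.classLqWeak μ p q f A F,
          μ {x | ENNReal.ofReal l ≤ TreeMaximal.maximal μ T φ x}) =
        min 1 (min (TreeMaximal.extremalG μ T q f A l) (ENNReal.ofReal (F ^ p / l ^ p)))) ∧
    -- the value of `G_{f,A}`
    (∀ l : ℝ, 0 < l →
      (l ≤ f → TreeMaximal.extremalG μ T q f A l = 1) ∧
      (f < l → l < (A / f) ^ (1 / (q - 1)) →
        TreeMaximal.extremalG μ T q f A l = ENNReal.ofReal (f / l)) ∧
      ((A / f) ^ (1 / (q - 1)) ≤ l →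
        ∃ k ∈ Set.Icc 0 (f / l),
          (∀ a ∈ Set.Icc 0 (f / l),
            (f - a * l) ^ q / (1 - a) ^ (q - 1) + a * l ^ q = A ↔ a = k) ∧
          TreeMaximal.extremalG μ T q f A l = ENNReal.ofReal k)) ∧
    -- sharpness of the weak type inequality
    (⨆ φ ∈ TreeMaximal.classLqWeak μ p q f A F,
        TreeMaximal.weakQuasiNorm μ p (TreeMaximal.maximal μ T φ)) = ENNReal.ofReal F := by
  obtain ⟨C, h⟩ := hT
  have hA0 : 0 < A := (Real.rpow_pos_of_pos hf q).trans hA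
  refine ⟨fun l hl => h.iSup_measure_classLqWeak hq hqp hf hfF hA hA' hl, fun l hl =>
    ⟨fun hlf => ?_, fun hfl hlA => ?_, fun hlA => ?_⟩,
    h.iSup_weakQuasiNorm_classLqWeak hq hqp hf hfF hA hA'⟩
  · exact h.extremalG_eq_one hlf
      ((h.classLqWeak_nonempty hq hqp hf hfF hA hA').mono fun φ hφ => hφ.1)
  · exact h.extremalG_eq_of_lt hq hf hfl ((lt_rpow_one_div_sub_one_iff hq hf hA0 hl).1 hlA)
  · have hfl := lt_of_rpow_one_div_sub_one_le hq hf hA hlA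
    have hAl : A ≤ f * l ^ (q - 1) :=
      not_lt.1 fun hlt => hlA.not_gt ((lt_rpow_one_div_sub_one_iff hq hf hA0 hl).2 hlt)
    obtain ⟨k, hk, hkA⟩ := exists_minPower_eq hq hf hfl hA hAl
    have hk' : k ∈ Set.Icc 0 (f / l) := ⟨hk.1.le, hk.2⟩
    refine ⟨k, hk', fun a ha => ?_, h.extremalG_eq_of_minPower_eq hq hf hfl hk hkA⟩
    rw [minPower_eq (ha.2.trans_lt ((div_lt_one hl).2 hfl)) ((le_div_iff₀ hl).1 ha.2), ← hkA]
    exact (minPower_strictMonoOn hq hf hfl).injOn.eq_iff ha hk'
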